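/- All powers $w^{s}$ are principal, $w^s=e^{s\log w}$ with $-\pi<\arg w\le\pi$. For $z,\omega_1,\dots,\omega_r\in\mathbf{C}\setminus\{0\}$ whose arguments pairwise differ by less than $\pi$, let $\zeta_r(s,z\mid\omega_1,\dots,\omega_r)$ be the Barnes zeta function, i.e. the meromorphic continuation to $s\in\mathbf{C}$ of $$\sum_{m_1,\dots,m_r\ge 0}(z+m_1\omega_1+\cdots+m_r\omega_r)^{-s}\qquad(\operatorname{Re}s>r).$$ For nonzero $\omega_0,z,\omega_1,\dots,\omega_{r-1}$ with $0<\arg\omega_0\le\pi$ and with $\arg z,\arg\omega_1,\dots,\arg\omega_{r-1}$ strictly between $\arg\omega_0-\pi$ and $\arg\omega_0$, let $$\xi_r(s,z\mid\omega_0;\omega_1,\dots,\omega_{r-1})=\zeta_r(s,z+\omega_0\mid\omega_0,\omega_1,\dots,\omega_{r-1})+\zeta_r(s,z\mid-\omega_0,\omega_1,\dots,\omega_{r-1})$$ be the bilateral zeta function. Let $r\ge2$, and let $\omega_1,\dots,\omega_r$ lie in the upper half-plane with $\arg\omega_1<\cdots<\arg\omega_r$. Write $\boldsymbol\omega=(\omega_1,\dots,\omega_r)$,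 $|\boldsymbol\omega|=\omega_1+\cdots+\omega_r$, $\boldsymbol\omega^{(k)}=(\omega_1,\dots,\omega_{k-1},-\omega_{k+1},\dots,-\omega_r)$, and $$D=\Big\{\sum_{k=1}^r a_k\omega_k : 0<a_1,\dots,a_r<1\Big\}\setminus\{0\},$$ $$D_+=\{z\ne0:\arg\omega_r<\arg z<\pi\},\qquad D_-=\{z\neq 0:0<\arg z<\arg\omega_1\},$$ $$f_+(s,z)=\zeta_r(s,-z\mid-\boldsymbol\omega)+(-1)^{r-1}\zeta_r(s,|\boldsymbol\omega|-z\mid\boldsymbol\omega),$$ $$f_-(s,z)=\zeta_r(s,z\mid\boldsymbol\omega)+(-1)^{r-1}\zeta_r(s,z-|\boldsymbol\omega|\mid-\boldsymbol\omega).$$ Here $\xi_r$ and $f_\pm$ are regarded as meromorphic functions of $s$ with removable singularities removed, and $1/\Gamma(s)=0$ for $s=0,-1,-2,\dots$. (1) If $z\in D\cup D_+$, then all Barnes zeta functions involved below are defined, that is, their series converge for $\operatorname{Re}s>r$ and have meromorphic continuations, and for all $s\in\mathbf{C}$ $$f_+(s,z)=\sum_{k=1}^r(-1)^{k-1}\,\xi_r\big(s,\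 \omega_1+\cdots+\omega_{k-1}-z\mid\omega_k;\boldsymbol\omega^{(k)}\big)$$ $$=\frac{e^{\frac{\pi}{2}is}(2\pi)^s}{\Gamma(s)}\sum_{k=1}^r\omega_k^{-s}\sum_{n=1}^\infty n^{s-1}e^{2\pi i n z/\omega_k}\prod_{j\ne k}\big(1-e^{2\pi i n\omega_j/\omega_k}\big)^{-1},$$ where the $r$ series over $n$ converge absolutely. (2) If $z\in D\cup D_-$, then likewise all Barnes zeta functions involved below are defined, and for all $s\in\mathbf{C}$ $$f_-(s,z)=\sum_{k=1}^r(-1)^{r-k}\,\xi_r\big(s,\ z-(\omega_{k+1}+\cdots+\omega_r)\mid\omega_k;\boldsymbol\omega^{(k)}\big)$$ $$=\frac{e^{\frac{\pi}{2}is}(2\pi)^s}{\Gamma(s)}\sum_{k=1}^r\omega_k^{-s}\sum_{n=1}^\infty n^{s-1}e^{-2\pi i n z/\omega_k}\prod_{j\ne k}\big(1-e^{-2\pi i n\omega_j/\omega_k}\big)^{-1},$$ where the $r$ series over $n$ converge absolutely. -/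

import Mathlib

open Complex

noncomputable section

/-- `F` is the `r`-ple Barnes zeta function `s ↦ ζ_r(s, z ∣ ω₁, …, ω_r)`: a meromorphic function on
the whole plane (normalised so that it takes the continuous value at every removable singularity)
which for `Re s > r` is the sum of the series `∑_{m ∈ ℕ₀ʳ} (z + m₁ω₁ + ⋯ + m_rω_r)^(-s)`.
The powers are principal, `-π < arg ≤ π`. -/
def IsBarnesZeta {r : ℕ} (z : ℂ) (ω : Fin r → ℂ) (F : ℂ → ℂ) : Prop :=
  MeromorphicNFOn F Set.univ ∧
    ∀ s : ℂ, (r : ℝ) < s.re →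
      HasSum (fun m : Fin r → ℕ => 1 / (z + ∑ j, (m j : ℂ) * ω j) ^ s) (F s)

/-- The series converges for `Re s > r` and has a meromorphic continuation to `ℂ`. -/
def HasBarnesZeta {r : ℕ} (z : ℂ) (ω : Fin r → ℂ) : Prop :=
  ∃ F : ℂ → ℂ, IsBarnesZeta z ω F

/-- There is at most one such function. -/
theorem IsBarnesZeta.unique {r : ℕ} {z : ℂ} {ω : Fin r → ℂ} {F G : ℂ → ℂ}
    (hF : IsBarnesZeta z ω F) (hG : IsBarnesZeta z ω G) : F = G := by
  have hm : MeromorphicOn (F - G) Set.univ :=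
    hF.1.meromorphicOn.sub hG.1.meromorphicOn
  have hopen : IsOpen {s : ℂ | (r : ℝ) < s.re} := isOpen_lt continuous_const Complex.continuous_re
  have h0 : meromorphicOrderAt (F - G) ((r : ℂ) + 1) = ⊤ := by
    rw [meromorphicOrderAt_eq_top_iff]
    refine Filter.Eventually.filter_mono nhdsWithin_le_nhds ?_
    filter_upwards [hopen.mem_nhds (show ((r : ℂ) + 1) ∈ {s : ℂ | (r : ℝ) < s.re} by simp)]
      with s hs
    simp [(hF.2 s hs).unique (hG.2 s hs)]
  funext x
  have hx : meromorphicOrderAt (F - G) x = ⊤ := by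
    by_contra hne
    exact hm.meromorphicOrderAt_ne_top_of_isPreconnected isPreconnected_univ
      (Set.mem_univ x) (Set.mem_univ _) hne h0
  rw [meromorphicOrderAt_eq_top_iff] at hx
  have h1 : F =ᶠ[nhdsWithin x {x}ᶜ] G := by
    filter_upwards [hx] with s hs
    exact sub_eq_zero.1 hs
  exact (((hF.1 (Set.mem_univ x)).eventuallyEq_nhdsNE_iff_eventuallyEq_nhds
    (hG.1 (Set.mem_univ x))).1 h1).eq_of_nhds

open Classical in
/-- The Barnes zeta function `ζ_r(s, z ∣ ω)`: the meromorphic continuation of the series. -/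
def barnesZeta {r : ℕ} (z : ℂ) (ω : Fin r → ℂ) : ℂ → ℂ :=
  if h : HasBarnesZeta z ω then Classical.choose h else 0

/-- Both Barnes zeta functions in the definition of `ξ_{r+1}(s, z ∣ ω₀; ω)` are defined. -/
def HasBilateralZeta {r : ℕ} (z ω₀ : ℂ) (ω : Fin r → ℂ) : Prop :=
  HasBarnesZeta (z + ω₀) (Fin.cons ω₀ ω : Fin (r + 1) → ℂ) ∧
    HasBarnesZeta z (Fin.cons (-ω₀) ω : Fin (r + 1) → ℂ)

/-- The bilateral zeta function, for `0 < arg ω₀ ≤ π`,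
`ξ_{r+1}(s, z ∣ ω₀; ω) = ζ_{r+1}(s, z + ω₀ ∣ ω₀, ω) + ζ_{r+1}(s, z ∣ -ω₀, ω)`, as a meromorphic
function of `s`, with removable singularities removed. -/
def bilateralZeta {r : ℕ} (z ω₀ : ℂ) (ω : Fin r → ℂ) : ℂ → ℂ :=
  toMeromorphicNFOn
    (fun s => barnesZeta (z + ω₀) (Fin.cons ω₀ ω : Fin (r + 1) → ℂ) s
      + barnesZeta z (Fin.cons (-ω₀) ω : Fin (r + 1) → ℂ) s)
    Set.univ

/-- `f₊(s, z ∣ ω) = ζ_r(s, -z ∣ -ω) + (-1)^(r-1) ζ_r(s, |ω|⁺ - z ∣ ω)`, as a meromorphic function of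
`s`, with removable singularities removed. -/
def fPlus {r : ℕ} (z : ℂ) (ω : Fin r → ℂ) : ℂ → ℂ :=
  toMeromorphicNFOn
    (fun s => barnesZeta (-z) (-ω) s + (-1) ^ (r - 1) * barnesZeta ((∑ j, ω j) - z) ω s)
    Set.univ

/-- `f₋(s, z ∣ ω) = ζ_r(s, z ∣ ω) + (-1)^(r-1) ζ_r(s, z - |ω|⁺ ∣ -ω)`, as a meromorphic function of
`s`, with removable singularities removed. -/
def fMinus {r : ℕ} (z : ℂ) (ω : Fin r → ℂ) : ℂ → ℂ :=
  toMeromorphicNFOn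
    (fun s => barnesZeta z ω s + (-1) ^ (r - 1) * barnesZeta (z - ∑ j, ω j) (-ω) s)
    Set.univ

/-- The vector `ω⁻[k, r] = (ω₁, …, ω_{k-1}, -ω_k, …, -ω_r)`. -/
def negFrom {r : ℕ} (k : Fin r) (ω : Fin r → ℂ) : Fin r → ℂ :=
  fun j => if k ≤ j then -ω j else ω j

/-- The open parallelotope `D`. -/
def domainD {r : ℕ} (ω : Fin r → ℂ) : Set ℂ :=
  {z | z ≠ 0 ∧ ∃ a : Fin r → ℝ, (∀ k, 0 < a k ∧ a k < 1) ∧ z = ∑ k, (a k : ℂ) * ω k}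

/-- The sector `D₊`, with `ω_r = ω (Fin.last n)`. -/
def domainDPlus {n : ℕ} (ω : Fin (n + 1) → ℂ) : Set ℂ :=
  {z | z ≠ 0 ∧ (ω (Fin.last n)).arg < z.arg ∧ z.arg < Real.pi}

/-- The sector `D₋`, with `ω₁ = ω 0`. -/
def domainDMinus {n : ℕ} (ω : Fin (n + 1) → ℂ) : Set ℂ :=
  {z | z ≠ 0 ∧ 0 < z.arg ∧ z.arg < (ω 0).arg}

/-- For `ε = 1` or `ε = -1`, the term
`n^(s-1) e^(2πi ε n z_k) ∏_{j ≠ k} (1 - e^(2πi ε n ω_{jk}))⁻¹`,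
where `z_k = z / ω_k` and `ω_{jk} = ω_j / ω_k`. -/
def fourierTerm {r : ℕ} (ε : ℂ) (z : ℂ) (ω : Fin r → ℂ) (s : ℂ) (k : Fin r) (n : ℕ+) : ℂ :=
  (n : ℂ) ^ (s - 1) * exp (2 * Real.pi * I * ε * n * (z / ω k)) *
    ∏ j ∈ Finset.univ.erase k, (1 - exp (2 * Real.pi * I * ε * n * (ω j / ω k)))⁻¹

end

/-! Put S_k = ζ_r(s, ω₁+⋯+ω_k − z ∣ ω₁,…,ω_k, −ω_{k+1},…,−ω_r). Up to the order of the parameters,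
the k-th bilateral zeta function is S_k + S_{k-1}, so the alternating sum telescopes to S_0 +
(-1)^(r-1) S_r = f₊ (`sum_neg_one_pow_mul_add`).

Everything rests on Im((ω₁+⋯+ω_{k-1} − z)/ω_k) < 0 for all k, which holds on D ∪ D₊
(`im_sub_neg_of_mem`). The signs in ω^(k) put the other periods on this same side of the line ℝω_k.
Hence all the zeta functions exist: after a rotation compatible with principal powers, each is a
Mellin transform divided by Γ, continued by the expansion of its kernel at 0.

For large Re s the two halves of a bilateral function fill whole lines u + ℤω_k. Each line is summed
by the Lipschitz formula, that is, Poisson summation (`tsum_lipschitz`), and the remaining sum over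
multi-indices is geometric. The resulting Fourier series is entire in s, so the identity theorem
extends the equality to all s.

Finally f₋(z) = (-1)^(r-1) f₊(|ω| − z). This moves the k-th base point by ω_k, which the Fourier
series does not see (`bilateralSeries_sub`). -/

noncomputable section BarnesZeta

open Filter Topology MeasureTheory Set Asymptotics

/-! ### Sums over multi-indices -/

/-- A finite product of absolutely convergent series is the sum over multi-indices. -/
theorem hasSum_prod_multiIndex {r : ℕ} {a : Fin r → ℕ → ℂ}
    (ha : ∀ j, Summable fun n => ‖a j n‖) :
    (Summable fun m : Fin r → ℕ => ‖∏ j, a j (m j)‖) ∧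
      HasSum (fun m : Fin r → ℕ => ∏ j, a j (m j)) (∏ j, ∑' n, a j n) := by
  induction r with
  | zero =>
    refine ⟨(hasSum_fintype _).summable, ?_⟩
    simp
  | succ r ih =>
    obtain ⟨h1, h2⟩ := ih (a := fun j => a j.succ) (fun j => ha j.succ)
    have h3 := (ha 0).mul_norm h1
    have key : ∀ p : ℕ × (Fin r → ℕ), ∏ j, a j ((Fin.consEquiv (fun _ => ℕ)) p j) =
        a 0 p.1 * ∏ j : Fin r, a j.succ (p.2 j) := by
      intro p
      rw [Fin.prod_univ_succ]
      simp [Fin.consEquiv]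
    constructor
    · rw [← (Fin.consEquiv (fun _ => ℕ)).summable_iff]
      refine h3.congr fun p => ?_
      simp only [Function.comp_apply, key]
    · rw [← (Fin.consEquiv (fun _ => ℕ)).hasSum_iff, Fin.prod_univ_succ]
      have h4 := ((ha 0).of_norm.hasSum).mul h2 h3.of_norm
      refine h4.congr_fun fun p => ?_
      simp only [Function.comp_apply, key]

theorem hasSum_prod_geometric {r : ℕ} {x : Fin r → ℂ} (hx : ∀ j, ‖x j‖ < 1) :
    (Summable fun m : Fin r → ℕ => ‖∏ j, x j ^ m j‖) ∧
      HasSum (fun m : Fin r → ℕ => ∏ j, x j ^ m j) (∏ j, (1 - x j)⁻¹) := by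
  have h := hasSum_prod_multiIndex (a := fun j n => x j ^ n)
    (fun j => by simpa using summable_geometric_of_lt_one (norm_nonneg _) (hx j))
  simpa only [tsum_geometric_of_norm_lt_one (hx _)] using h

theorem exists_pos_le_all {r : ℕ} {x : ℝ} (hx : 0 < x) {y : Fin r → ℝ} (hy : ∀ j, 0 < y j) :
    ∃ δ : ℝ, 0 < δ ∧ δ ≤ x ∧ ∀ j, δ ≤ y j := by
  have h : ∀ᶠ δ : ℝ in 𝓝[>] 0, 0 < δ ∧ δ ≤ x ∧ ∀ j, δ ≤ y j := by
    refine eventually_mem_nhdsWithin.and (.and ?_ (eventually_all.2 fun j => ?_))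
    · exact (eventually_le_nhds hx).filter_mono nhdsWithin_le_nhds
    · exact (eventually_le_nhds (hy j)).filter_mono nhdsWithin_le_nhds
  exact h.exists

/-- With δ a lower bound for x and all y_j, the base is at least δ(1 + Σ m_j), and (1 + Σ m_j)^r ≥ ∏
(1 + m_j). So the term is at most δ^(-σ) ∏ (1 + m_j)^(-σ/r), a product of convergent one-variable
series since σ/r > 1. -/
theorem summable_add_sum_rpow {r : ℕ} {x : ℝ} (hx : 0 < x) {y : Fin r → ℝ} (hy : ∀ j, 0 < y j)
    {σ : ℝ} (hσ : (r : ℝ) < σ) :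
    Summable fun m : Fin r → ℕ => (x + ∑ j, (m j : ℝ) * y j) ^ (-σ) := by
  obtain ⟨δ, hδ, hδx, hδy⟩ := exists_pos_le_all hx hy
  rcases Nat.eq_zero_or_pos r with rfl | hr
  · exact (hasSum_fintype _).summable
  have hr' : (0 : ℝ) < r := by exact_mod_cast hr
  have hσ0 : 0 < σ := hr'.trans hσ
  have h1 : 1 < σ / r := by rwa [one_lt_div hr']
  have h2 : Summable fun n : ℕ => ((1 : ℝ) + n) ^ (-(σ / r)) := by
    have := (summable_nat_add_iff 1).2 (Real.summable_nat_rpow.2 (neg_lt_neg h1))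
    refine this.congr fun n => ?_
    push_cast
    rw [add_comm]
  have h3 := (hasSum_prod_multiIndex (r := r)
    (a := fun _ n => (((1 : ℝ) + n) ^ (-(σ / r)) : ℝ)) (fun _ => by
      simpa using h2.congr fun n => (abs_of_nonneg (by positivity)).symm)).1
  refine Summable.of_nonneg_of_le (fun m => ?_) (fun m => ?_) (h3.mul_left (δ ^ (-σ)))
  · have : 0 ≤ ∑ j, (m j : ℝ) * y j :=
      Finset.sum_nonneg fun j _ => mul_nonneg (Nat.cast_nonneg _) (hy j).le
    positivity
  have hS : 0 ≤ ∑ j, (m j : ℝ) := Finset.sum_nonneg fun j _ => Nat.cast_nonneg _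
  have h4 : δ * (1 + ∑ j, (m j : ℝ)) ≤ x + ∑ j, (m j : ℝ) * y j := by
    rw [mul_add, mul_one, Finset.mul_sum]
    refine add_le_add hδx (Finset.sum_le_sum fun j _ => ?_)
    rw [mul_comm]
    exact mul_le_mul_of_nonneg_left (hδy j) (Nat.cast_nonneg _)
  have h5 : ∏ j, (1 + (m j : ℝ)) ≤ (1 + ∑ j, (m j : ℝ)) ^ r := by
    have : ∏ j : Fin r, (1 + (m j : ℝ)) ≤ ∏ _j : Fin r, (1 + ∑ j, (m j : ℝ)) := by
      refine Finset.prod_le_prod (fun j _ => by positivity) fun j _ => ?_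
      gcongr
      exact Finset.single_le_sum (f := fun j => (m j : ℝ)) (fun j _ => Nat.cast_nonneg _)
        (Finset.mem_univ j)
    simpa using this
  calc (x + ∑ j, (m j : ℝ) * y j) ^ (-σ)
      ≤ (δ * (1 + ∑ j, (m j : ℝ))) ^ (-σ) :=
        Real.rpow_le_rpow_of_nonpos (by positivity) h4 (by linarith)
    _ = δ ^ (-σ) * ((1 + ∑ j, (m j : ℝ)) ^ r) ^ (-(σ / r)) := by
        rw [Real.mul_rpow hδ.le (by positivity), ← Real.rpow_natCast_mul (by positivity)]
        congr 2
        field_simp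
    _ ≤ δ ^ (-σ) * (∏ j, (1 + (m j : ℝ))) ^ (-(σ / r)) := by
        gcongr ?_ * ?_
        refine Real.rpow_le_rpow_of_nonpos (Finset.prod_pos fun j _ => by positivity) h5 ?_
        have := div_pos hσ0 hr'
        linarith
    _ = δ ^ (-σ) * ‖∏ j, ((((1 : ℝ) + m j) ^ (-(σ / r)) : ℝ) : ℂ)‖ := by
        rw [← Real.finsetProd_rpow _ _ (fun j _ => by positivity), ← ofReal_prod, norm_real,
          Real.norm_of_nonneg (Finset.prod_nonneg fun j _ => by positivity)]

/-! ### Gamma integrals and Mellin transforms of exponential series -/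

theorem integrableOn_rpow_mul_exp_neg {a b : ℝ} (ha : 0 < a) (hb : 0 < b) :
    IntegrableOn (fun t : ℝ => t ^ (a - 1) * Real.exp (-b * t)) (Ioi 0) := by
  have := integrableOn_rpow_mul_exp_neg_mul_rpow (s := a - 1) (p := 1) (by linarith) one_pos hb
  simpa using this

theorem aestronglyMeasurable_cpow_mul_exp (a p : ℂ) :
    AEStronglyMeasurable (fun t : ℝ => (t : ℂ) ^ a * exp (-(p * t))) (volume.restrict (Ioi 0)) := by
  refine ContinuousOn.aestronglyMeasurable ?_ measurableSet_Ioi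
  refine ContinuousOn.mul (fun t ht => ?_) (by fun_prop)
  exact (continuousAt_ofReal_cpow_const _ _ (Or.inr (ne_of_gt ht))).continuousWithinAt

theorem norm_cpow_mul_exp {t : ℝ} (ht : 0 < t) (a p : ℂ) :
    ‖(t : ℂ) ^ a * exp (-(p * t))‖ = t ^ a.re * Real.exp (-p.re * t) := by
  rw [norm_mul, norm_cpow_eq_rpow_re_of_pos ht, norm_exp]
  simp

theorem integrableOn_cpow_mul_exp {a p : ℂ} (ha : 0 < a.re) (hp : 0 < p.re) :
    IntegrableOn (fun t : ℝ => (t : ℂ) ^ (a - 1) * exp (-(p * t))) (Ioi 0) := by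
  refine Integrable.mono' (integrableOn_rpow_mul_exp_neg ha hp)
    (aestronglyMeasurable_cpow_mul_exp _ _) ?_
  refine (ae_restrict_mem measurableSet_Ioi).mono fun t ht => ?_
  rw [norm_cpow_mul_exp ht]
  simp

/-- The Gamma integral with a complex rate. -/
theorem integral_cpow_mul_cexp {a p : ℂ} (ha : 0 < a.re) (hp : 0 < p.re) :
    ∫ t : ℝ in Ioi 0, (t : ℂ) ^ (a - 1) * exp (-(p * t)) = Gamma a / p ^ a := by
  -- Both sides are holomorphic in p on the right half-plane and agree for real p > 0, a set
  -- accumulating at 1.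
  set U : Set ℂ := {p | 0 < p.re}
  have hU : IsOpen U := isOpen_lt continuous_const continuous_re
  have hc : IsPreconnected U := (convex_halfSpace_re_gt 0).isPreconnected
  have hd : DifferentiableOn ℂ
      (fun p => ∫ t : ℝ in Ioi 0, (t : ℂ) ^ (a - 1) * exp (-(p * t))) U := by
    intro p (hp : 0 < p.re)
    refine DifferentiableAt.differentiableWithinAt ?_
    have hs : {q : ℂ | p.re / 2 < q.re} ∈ 𝓝 p :=
      (isOpen_lt continuous_const continuous_re).mem_nhds (by simp; linarith)
    have := hasDerivAt_integral_of_dominated_loc_of_deriv_le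
      (μ := volume.restrict (Ioi (0 : ℝ)))
      (F := fun (q : ℂ) (t : ℝ) => (t : ℂ) ^ (a - 1) * exp (-(q * t)))
      (F' := fun (q : ℂ) (t : ℝ) => (t : ℂ) ^ (a - 1) * (exp (-(q * t)) * -t))
      -- The derivative in q brings down a factor t, raising the exponent by one; the decay rate is
      -- uniform on Re q > Re p / 2.
      (bound := fun t => t ^ ((a.re + 1) - 1) * Real.exp (-(p.re / 2) * t)) hs
      (Eventually.of_forall fun q => aestronglyMeasurable_cpow_mul_exp _ _)
      (integrableOn_cpow_mul_exp ha hp) ?_ ?_ (integrableOn_rpow_mul_exp_neg (by linarith)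
        (by linarith)) ?_
    · exact this.2.differentiableAt
    · have h := (aestronglyMeasurable_cpow_mul_exp (a - 1) p).mul
        ((by fun_prop : Continuous fun t : ℝ => -(t : ℂ)).aestronglyMeasurable
          (μ := volume.restrict (Ioi (0 : ℝ))))
      refine h.congr (Eventually.of_forall fun t => ?_)
      simp [mul_assoc]
    · refine (ae_restrict_mem measurableSet_Ioi).mono fun t (ht : 0 < t) q hq => ?_
      rw [← mul_assoc, norm_mul, norm_cpow_mul_exp ht]
      simp only [norm_neg, norm_real, Real.norm_of_nonneg ht.le, sub_re, one_re,
        add_sub_cancel_right]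
      rw [mul_right_comm, ← Real.rpow_add_one ht.ne', sub_add_cancel]
      have hq' : p.re / 2 < q.re := hq
      gcongr
    · refine Eventually.of_forall fun t q _ => ?_
      have h1 : HasDerivAt (fun q : ℂ => -(q * t)) (-(t : ℂ)) q := 
        (hasDerivAt_mul_const (t : ℂ)).fun_neg
      exact (h1.cexp).const_mul _
  have hd2 : DifferentiableOn ℂ (fun p => Gamma a / p ^ a) U := by
    intro p (hp : 0 < p.re)
    have hp' : p ∈ slitPlane := Or.inl hp
    refine (DifferentiableAt.div (by fun_prop) ?_ ?_).differentiableWithinAt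
    · exact (differentiableAt_id.cpow_const hp')
    · simp [cpow_eq_zero_iff, slitPlane_ne_zero hp']
  refine (hd.analyticOnNhd hU).eqOn_of_preconnected_of_frequently_eq (hd2.analyticOnNhd hU) hc
    (z₀ := 1) (by simp [U]) ?_ hp
  have hreal : ∀ x : ℝ, 0 < x →
      ∫ t : ℝ in Ioi 0, (t : ℂ) ^ (a - 1) * exp (-((x : ℂ) * t)) = Gamma a / (x : ℂ) ^ a := by
    intro x hx
    rw [integral_cpow_mul_exp_neg_mul_Ioi ha hx, one_div, inv_cpow, inv_mul_eq_div]
    rw [arg_ofReal_of_nonneg hx.le]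
    exact Real.pi_pos.ne
  have ht : Tendsto (fun x : ℝ => (x : ℂ)) (𝓝[≠] 1) (𝓝[≠] 1) := by
    refine tendsto_nhdsWithin_iff.2 ⟨?_, ?_⟩
    · exact (by simpa using continuous_ofReal.tendsto 1 : Tendsto _ (𝓝 (1:ℝ)) (𝓝 (1:ℂ))).mono_left
        nhdsWithin_le_nhds
    · refine eventually_mem_nhdsWithin.mono fun x hx => ?_
      simpa using hx
  refine ht.frequently (Eventually.frequently ?_)
  refine Eventually.filter_mono nhdsWithin_le_nhds ?_
  exact (eventually_gt_nhds zero_lt_one).mono hreal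

/-- The Mellin transform of a series of exponentials with complex exponents. -/
theorem hasSum_mellin_cexp {ι : Type*} [Countable ι] {p : ι → ℂ} {F : ℝ → ℂ} {s : ℂ}
    (hp : ∀ i, 0 < (p i).re) (hs : 0 < s.re)
    (hF : ∀ t ∈ Ioi (0 : ℝ), HasSum (fun i => exp (-(p i * t))) (F t))
    (hsum : Summable fun i => (p i).re ^ (-s.re)) :
    HasSum (fun i => Gamma s / p i ^ s) (mellin F s) := by
  simp_rw [mellin, smul_eq_mul, ← setIntegral_congr_fun measurableSet_Ioi
    (fun t ht => congr_arg _ (hF t ht).tsum_eq), ← tsum_mul_left]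
  convert! hasSum_integral_of_summable_integral_norm
    (F := fun i (t : ℝ) => (t : ℂ) ^ (s - 1) * exp (-(p i * t))) (fun i => ?_) ?_ using 2 with i
  · exact (integral_cpow_mul_cexp hs (hp i)).symm
  · exact integrableOn_cpow_mul_exp hs (hp i)
  · refine (hsum.mul_left (Real.Gamma s.re)).congr fun i => ?_
    have h := Real.integral_rpow_mul_exp_neg_mul_Ioi hs (hp i)
    rw [one_div, Real.inv_rpow (hp i).le, ← Real.rpow_neg (hp i).le, mul_comm] at h
    rw [← h]
    refine setIntegral_congr_fun measurableSet_Ioi fun t ht => ?_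
    rw [norm_cpow_mul_exp ht]
    simp

/-! ### Identity theorem and gluing of continuations -/

/-- Identity theorem for meromorphic functions in normal form. -/
theorem MeromorphicNFOn.eqOn_of_eventuallyEq {F G : ℂ → ℂ} {U : Set ℂ} (hU : IsPreconnected U)
    (hF : MeromorphicNFOn F U) (hG : MeromorphicNFOn G U) {x₀ : ℂ} (hx₀ : x₀ ∈ U)
    (h : F =ᶠ[𝓝[≠] x₀] G) : EqOn F G U := by
  have hm : MeromorphicOn (F - G) U := hF.meromorphicOn.sub hG.meromorphicOn
  have h0 : meromorphicOrderAt (F - G) x₀ = ⊤ := by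
    rw [meromorphicOrderAt_eq_top_iff]
    filter_upwards [h] with s hs
    simp [hs]
  intro x hxU
  have hx : meromorphicOrderAt (F - G) x = ⊤ := by
    by_contra hne
    exact hm.meromorphicOrderAt_ne_top_of_isPreconnected hU hxU hx₀ hne h0
  rw [meromorphicOrderAt_eq_top_iff] at hx
  have h1 : F =ᶠ[𝓝[≠] x] G := by
    filter_upwards [hx] with s hs
    exact sub_eq_zero.1 hs
  exact (((hF hxU).eventuallyEq_nhdsNE_iff_eventuallyEq_nhds (hG hxU)).1 h1).eq_of_nhds

theorem isOpen_lt_re (c : ℝ) : IsOpen {s : ℂ | c < s.re} := isOpen_lt continuous_const continuous_re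

theorem isPreconnected_lt_re (c : ℝ) : IsPreconnected {s : ℂ | c < s.re} :=
  (convex_halfSpace_re_gt c).isPreconnected

/-- A meromorphic function that agrees with an entire function on a right half-plane is equal to it,
once its removable singularities are removed. -/
theorem toMeromorphicNFOn_eq_of_eqOn_halfPlane {G E : ℂ → ℂ} (hG : MeromorphicOn G univ)
    (hE : Differentiable ℂ E) {c : ℝ} (h : ∀ s : ℂ, c < s.re → G s = E s) :
    toMeromorphicNFOn G univ = E := by
  have hE' : MeromorphicNFOn E univ :=
    (analyticOnNhd_univ_iff_differentiable.2 hE).meromorphicNFOn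
  have hx : ((c + 1 : ℝ) : ℂ) ∈ {s : ℂ | c < s.re} := by simp
  have h1 : toMeromorphicNFOn G univ =ᶠ[𝓝[≠] ((c + 1 : ℝ) : ℂ)] E :=
    (hG.toMeromorphicNFOn_eq_self_on_nhdsNE (mem_univ _)).trans
      (eventually_nhdsWithin_of_eventually_nhds
        (Filter.mem_of_superset ((isOpen_lt_re c).mem_nhds hx) fun s hs => h s hs))
  exact eqOn_univ _ _ |>.1 (MeromorphicNFOn.eqOn_of_eventuallyEq isPreconnected_univ
    (meromorphicNFOn_toMeromorphicNFOn _ _) hE' (mem_univ _) h1)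

/-- Meromorphic continuations to larger and larger half-planes glue. -/
theorem exists_meromorphicNFOn_of_halfPlanes {f : ℂ → ℂ} {c : ℝ}
    (hf : DifferentiableOn ℂ f {s | c < s.re})
    (h : ∀ N : ℕ, ∃ F : ℂ → ℂ, MeromorphicOn F {s | c - N < s.re} ∧
      ∀ s : ℂ, c < s.re → F s = f s) :
    ∃ F : ℂ → ℂ, MeromorphicNFOn F univ ∧ ∀ s : ℂ, c < s.re → F s = f s := by
  choose F hF hFf using h
  set G : ℕ → ℂ → ℂ := fun N => toMeromorphicNFOn (F N) {s | c - N < s.re} with hGdef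
  have hG : ∀ N, MeromorphicNFOn (G N) {s | c - N < s.re} := fun N =>
    meromorphicNFOn_toMeromorphicNFOn _ _
  have hsub : ∀ N : ℕ, {s : ℂ | c < s.re} ⊆ {s | c - N < s.re} := fun N s hs => by
    have : (0 : ℝ) ≤ N := Nat.cast_nonneg N
    simp only [mem_ofPred_eq] at hs ⊢
    linarith
  have hmono : ∀ M N : ℕ, M ≤ N → {s : ℂ | c - M < s.re} ⊆ {s | c - N < s.re} :=
    fun M N hMN s hs => by
      have : (M : ℝ) ≤ N := Nat.cast_le.2 hMN
      simp only [mem_ofPred_eq] at hs ⊢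
      linarith
  have hfa := (hf.analyticOnNhd (isOpen_lt_re c)).meromorphicNFOn
  have hGf : ∀ N, EqOn (G N) f {s | c < s.re} := fun N s hs => by
    have h1 : G N =ᶠ[𝓝[≠] s] f :=
      ((hF N).toMeromorphicNFOn_eq_self_on_nhdsNE (hsub N hs)).trans
        (eventually_nhdsWithin_of_eventually_nhds
          (Filter.mem_of_superset ((isOpen_lt_re c).mem_nhds hs) fun s hs => hFf N s hs))
    exact (((hG N (hsub N hs)).eventuallyEq_nhdsNE_iff_eventuallyEq_nhds (hfa hs)).1 h1).eq_of_nhds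
  have hx : ((c + 1 : ℝ) : ℂ) ∈ {s : ℂ | c < s.re} := by simp
  have hGG : ∀ M N : ℕ, M ≤ N → EqOn (G M) (G N) {s | c - M < s.re} := fun M N hMN => by
    refine MeromorphicNFOn.eqOn_of_eventuallyEq (isPreconnected_lt_re _) (hG M)
      (fun s hs => hG N (hmono M N hMN hs)) (hsub M hx) ?_
    refine eventually_nhdsWithin_of_eventually_nhds ?_
    filter_upwards [(isOpen_lt_re c).mem_nhds hx] with s hs
    rw [hGf M hs, hGf N hs]
  have hex : ∀ s : ℂ, ∃ N : ℕ, c - N < s.re := fun s => by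
    obtain ⟨N, hN⟩ := exists_nat_gt (c - s.re)
    exact ⟨N, by linarith⟩
  choose N hN using hex
  -- The value at s does not depend on the half-plane chosen to contain s, so near each point the
  -- glued function is a single `G M`.
  have hloc : ∀ M : ℕ, EqOn (fun s => G (N s) s) (G M) {s | c - M < s.re} := fun M s hs => by
    rcases le_total M (N s) with hle | hle
    · exact (hGG M (N s) hle hs).symm
    · exact hGG (N s) M hle (hN s)
  refine ⟨fun s => G (N s) s, fun s _ => ?_, fun s hs => hGf (N s) hs⟩
  refine (meromorphicNFAt_congr ?_).1 (hG (N s) (hN s))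
  filter_upwards [(isOpen_lt_re _).mem_nhds (hN s)] with t ht
  exact (hloc (N s) ht).symm

/-- Continuation of a Mellin transform by means of an asymptotic expansion at the origin. -/
theorem exists_meromorphicOn_mellin {f : ℝ → ℂ} {r N : ℕ} {a : ℝ} (ha : 0 < a)
    (hc : ContinuousOn f (Ioi 0)) (htop : f =O[atTop] fun t => Real.exp (-a * t)) (c : ℕ → ℂ)
    (hbot : (fun t : ℝ => f t - ∑ k ∈ Finset.range N, c k * (t : ℂ) ^ ((k : ℂ) - r))
      =O[𝓝[>] 0] fun t : ℝ => t ^ ((N : ℝ) - r)) :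
    ∃ F : ℂ → ℂ, MeromorphicOn F {s | (r : ℝ) - N < s.re} ∧
      ∀ s : ℂ, (r : ℝ) < s.re → F s = mellin f s := by
  -- Only the truncations of the powers to (0, 1] are subtracted. Their Mellin transforms 1/(s + k −
  -- r) are meromorphic everywhere, while the remainder still equals f beyond 1 and is O(t^(N−r)) at
  -- 0, so its transform is holomorphic for Re s > r − N.
  set e : ℕ → ℝ → ℂ := fun k => indicator (Ioc 0 1) fun t : ℝ => (t : ℂ) ^ ((k : ℂ) - r) with he
  set S : ℝ → ℂ := fun t => ∑ k ∈ Finset.range N, c k • e k t with hS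
  set g : ℝ → ℂ := fun t => f t - S t with hg
  have hfl : LocallyIntegrableOn f (Ioi 0) := hc.locallyIntegrableOn measurableSet_Ioi
  have hel : ∀ k, LocallyIntegrableOn (e k) (Ioi 0) := fun k x hx => by
    have hcont : ContinuousOn (fun t : ℝ => (t : ℂ) ^ ((k : ℂ) - r)) (Ioi 0) := fun t ht =>
      (continuousAt_ofReal_cpow_const _ _ (Or.inr (ne_of_gt ht))).continuousWithinAt
    obtain ⟨u, hu, hi⟩ := hcont.locallyIntegrableOn measurableSet_Ioi (μ := volume) x hx
    exact ⟨u, hu, hi.indicator measurableSet_Ioc⟩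
  have hSl : LocallyIntegrableOn S (Ioi 0) := by
    have : ∀ T : Finset ℕ, LocallyIntegrableOn (fun t => ∑ k ∈ T, c k • e k t) (Ioi 0) := by
      intro T
      induction T using Finset.induction_on with
      | empty => simpa using (locallyIntegrable_zero).locallyIntegrableOn _
      | insert k T hk ih =>
        simp only [Finset.sum_insert hk]
        exact ((hel k).smul (c k)).add ih
    exact this _
  have hgl : LocallyIntegrableOn g (Ioi 0) := hfl.sub hSl
  have hgtop : g =O[atTop] fun t => Real.exp (-a * t) := by
    refine htop.congr' ?_ (Eventually.of_forall fun _ => rfl)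
    filter_upwards [eventually_gt_atTop 1] with t ht
    simp [hg, hS, he, not_le.2 ht]
  have hgbot : g =O[𝓝[>] 0] fun t : ℝ => t ^ (-((r : ℝ) - N)) := by
    refine hbot.congr' ?_ (Eventually.of_forall fun t => by simp)
    have h1 : ∀ᶠ t : ℝ in 𝓝[>] 0, t < 1 :=
      (eventually_lt_nhds zero_lt_one).filter_mono nhdsWithin_le_nhds
    filter_upwards [h1, self_mem_nhdsWithin] with t ht ht0
    have : t ∈ Ioc (0 : ℝ) 1 := ⟨ht0, ht.le⟩
    simp [hg, hS, he, this]
  refine ⟨fun s => mellin g s + ∑ k ∈ Finset.range N, c k • (1 / (s + ((k : ℂ) - r))), ?_, ?_⟩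
  · have h1 : DifferentiableOn ℂ (mellin g) {s | (r : ℝ) - N < s.re} := fun s hs =>
      (mellin_differentiableAt_of_isBigO_rpow_exp ha hgl hgtop hgbot hs).differentiableWithinAt
    have h2 := (h1.analyticOnNhd (isOpen_lt_re _)).meromorphicOn
    intro s hs
    refine (h2 s hs).add (MeromorphicAt.fun_sum fun k _ => ?_)
    fun_prop
  · intro s hs
    have hgs : MellinConvergent g s := by
      refine mellinConvergent_of_isBigO_rpow_exp ha hgl hgtop hgbot ?_
      have : (0 : ℝ) ≤ N := Nat.cast_nonneg N
      linarith
    have hes : ∀ k, HasMellin (e k) s (1 / (s + ((k : ℂ) - r))) := fun k => by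
      refine hasMellin_cpow_Ioc _ ?_
      have : (0 : ℝ) ≤ k := Nat.cast_nonneg k
      simp
      linarith
    have hSs : HasMellin S s (∑ k ∈ Finset.range N, c k • (1 / (s + ((k : ℂ) - r)))) := by
      have : ∀ T : Finset ℕ, HasMellin (fun t => ∑ k ∈ T, c k • e k t) s
          (∑ k ∈ T, c k • (1 / (s + ((k : ℂ) - r)))) := by
        intro T
        induction T using Finset.induction_on with
        | empty => simp [HasMellin, MellinConvergent, mellin]
        | insert k T hk ih =>
          simp only [Finset.sum_insert hk]
          have h1 := hasMellin_const_smul (hes k).1 (c k)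
          have h2 := hasMellin_add h1.1 ih.1
          rwa [h1.2, ih.2, (hes k).2] at h2
      exact this _
    have := (hasMellin_add hgs hSs.1).2
    rw [hSs.2] at this
    beta_reduce
    rw [← this]
    simp [hg]

/-! ### Kernel and existence of the Barnes zeta function -/

/-- The function whose Mellin transform is `Γ(s) ζ_r(s, z ∣ ω)`. -/
def barnesKernel {r : ℕ} (z : ℂ) (ω : Fin r → ℂ) (t : ℝ) : ℂ :=
  exp (-(z * t)) * ∏ j, (1 - exp (-(ω j * t)))⁻¹

theorem norm_exp_neg_mul_lt_one {p : ℂ} (hp : 0 < p.re) {t : ℝ} (ht : 0 < t) :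
    ‖exp (-(p * t))‖ < 1 := by
  rw [norm_exp]
  simpa using mul_pos hp ht

theorem one_sub_exp_ne_zero {p : ℂ} (hp : 0 < p.re) {t : ℝ} (ht : 0 < t) :
    1 - exp (-(p * t)) ≠ 0 := fun h => by
  have := norm_exp_neg_mul_lt_one hp ht
  rw [← sub_eq_zero.1 h] at this
  simp at this

section Kernel

variable {r : ℕ} {z : ℂ} {ω : Fin r → ℂ}

theorem continuousOn_barnesKernel (hω : ∀ j, 0 < (ω j).re) :
    ContinuousOn (barnesKernel z ω) (Ioi 0) := by
  refine ContinuousOn.mul (by fun_prop) (continuousOn_finsetProd _ fun j _ => ?_)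
  exact ContinuousOn.inv₀ (by fun_prop) fun t ht => one_sub_exp_ne_zero (hω j) ht

theorem tendsto_one_sub_exp_inv {p : ℂ} (hp : 0 < p.re) :
    Tendsto (fun t : ℝ => (1 - exp (-(p * t)))⁻¹) atTop (𝓝 1) := by
  have h : Tendsto (fun t : ℝ => exp (-(p * t))) atTop (𝓝 0) := by
    rw [tendsto_zero_iff_norm_tendsto_zero]
    simp only [norm_exp]
    refine Real.tendsto_exp_atBot.comp ?_
    simp only [neg_re, mul_re, ofReal_re, ofReal_im, mul_zero, sub_zero]
    exact tendsto_neg_atTop_atBot.comp (tendsto_id.const_mul_atTop hp)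
  simpa using (tendsto_const_nhds.sub h).inv₀ (by simp : (1 : ℂ) - 0 ≠ 0)

theorem barnesKernel_isBigO_atTop (hω : ∀ j, 0 < (ω j).re) :
    barnesKernel z ω =O[atTop] fun t => Real.exp (-z.re * t) := by
  have h1 : (fun t : ℝ => exp (-(z * t))) =O[atTop] fun t => Real.exp (-z.re * t) :=
    isBigO_of_le _ fun t => by simp [norm_exp]
  have h2 : (fun t : ℝ => ∏ j, (1 - exp (-(ω j * t)))⁻¹) =O[atTop] fun _ => (1 : ℝ) :=
    (tendsto_finsetProd _ fun j _ => tendsto_one_sub_exp_inv (hω j)).isBigO_one ℝ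
  refine (h1.mul h2).congr_right fun t => mul_one _

/-- Each t/(1 − e^(−ω_j t)) extends analytically to 0, being the inverse of a divided difference
with value ω_j ≠ 0 there. So t^r times the kernel is analytic at 0, and its Taylor coefficients
serve for every N. -/
theorem barnesKernel_expansion (hω : ∀ j, 0 < (ω j).re) :
    ∃ c : ℕ → ℂ, ∀ N : ℕ,
      (fun t : ℝ => barnesKernel z ω t - ∑ k ∈ Finset.range N, c k * (t : ℂ) ^ ((k : ℂ) - r))
        =O[𝓝[>] 0] fun t : ℝ => t ^ ((N : ℝ) - r) := by
  set H : ℂ → ℂ := fun w =>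
    exp (-(z * w)) * ∏ j, (dslope (fun w => 1 - exp (-(ω j * w))) 0 w)⁻¹ with hH
  have hHa : AnalyticAt ℂ H 0 := by
    refine AnalyticAt.mul (by fun_prop) (Finset.analyticAt_fun_prod _ fun j _ => ?_)
    have h1 : AnalyticAt ℂ (fun w => 1 - exp (-(ω j * w))) 0 := by fun_prop
    obtain ⟨p, hp⟩ := h1
    refine AnalyticAt.inv ⟨_, hp.has_fpower_series_dslope_fslope⟩ ?_
    rw [dslope_same]
    have h2 : HasDerivAt (fun w => 1 - exp (-(ω j * w))) (ω j) 0 := by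
      have h3 : HasDerivAt (fun w => -(ω j * w)) (-(ω j)) 0 := (hasDerivAt_const_mul (ω j)).fun_neg
      simpa using h3.cexp.const_sub 1
    rw [h2.deriv]
    intro h
    have := hω j
    simp [h] at this
  have hHK : ∀ t : ℝ, 0 < t → H t = (t : ℂ) ^ r * barnesKernel z ω t := by
    intro t ht
    have ht' : (t : ℂ) ≠ 0 := ofReal_ne_zero.2 ht.ne'
    simp only [hH, barnesKernel]
    have : ∀ j, (dslope (fun w => 1 - exp (-(ω j * w))) 0 (t : ℂ))⁻¹ =
        t * (1 - exp (-(ω j * t)))⁻¹ := by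
      intro j
      rw [dslope_of_ne _ ht', slope_def_field]
      simp [div_eq_mul_inv, mul_comm]
    simp only [this, Finset.prod_mul_distrib]
    simp
    ring
  obtain ⟨p, hp⟩ := hHa
  refine ⟨fun k => p.coeff k, fun N => ?_⟩
  have ht0 : Tendsto (fun t : ℝ => (t : ℂ)) (𝓝[>] 0) (𝓝 0) :=
    (by simpa using continuous_ofReal.tendsto 0 : Tendsto _ (𝓝 (0 : ℝ)) (𝓝 (0 : ℂ))).mono_left
      nhdsWithin_le_nhds
  have h1 := (hp.isBigO_sub_partialSum_pow N).comp_tendsto ht0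
  have h2 : (fun t : ℝ => (t : ℂ) ^ (-(r : ℂ))) =O[𝓝[>] 0] fun t : ℝ => t ^ (-(r : ℝ)) := by
    refine IsBigO.of_norm_eventuallyLE ?_
    filter_upwards [self_mem_nhdsWithin] with t ht
    rw [norm_cpow_eq_rpow_re_of_pos ht]
    simp
  refine (h2.mul h1).congr' ?_ ?_
  · filter_upwards [self_mem_nhdsWithin] with t ht
    have ht' : (t : ℂ) ≠ 0 := ofReal_ne_zero.2 (ne_of_gt ht)
    simp only [Function.comp_apply, zero_add, hHK t ht, FormalMultilinearSeries.partialSum,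
      FormalMultilinearSeries.apply_eq_pow_smul_coeff, smul_eq_mul, mul_sub, Finset.mul_sum]
    congr 1
    · rw [← mul_assoc, cpow_neg, cpow_natCast, inv_mul_cancel₀ (pow_ne_zero _ ht'), one_mul]
    · refine Finset.sum_congr rfl fun k _ => ?_
      rw [← mul_assoc, ← cpow_natCast, ← cpow_add _ _ ht', mul_comm]
      congr 2
      ring
  · filter_upwards [self_mem_nhdsWithin] with t ht
    have ht : 0 < t := ht
    simp only [Function.comp_apply, norm_real, Real.norm_of_nonneg ht.le]
    rw [← Real.rpow_natCast, ← Real.rpow_add ht]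
    congr 1
    ring

theorem add_sum_re (m : Fin r → ℕ) :
    (z + ∑ j, (m j : ℂ) * ω j).re = z.re + ∑ j, (m j : ℝ) * (ω j).re := by
  simp

theorem add_sum_re_pos (hz : 0 < z.re) (hω : ∀ j, 0 < (ω j).re) (m : Fin r → ℕ) :
    0 < (z + ∑ j, (m j : ℂ) * ω j).re := by
  rw [add_sum_re]
  have : 0 ≤ ∑ j, (m j : ℝ) * (ω j).re :=
    Finset.sum_nonneg fun j _ => mul_nonneg (Nat.cast_nonneg _) (hω j).le
  linarith

theorem hasSum_barnesKernel (hω : ∀ j, 0 < (ω j).re) {t : ℝ} (ht : 0 < t) :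
    HasSum (fun m : Fin r → ℕ => exp (-((z + ∑ j, (m j : ℂ) * ω j) * t)))
      (barnesKernel z ω t) := by
  have h := (hasSum_prod_geometric (x := fun j => exp (-(ω j * t)))
    fun j => norm_exp_neg_mul_lt_one (hω j) ht).2.mul_left (exp (-(z * t)))
  refine h.congr_fun fun m => ?_
  simp only [← exp_nat_mul, ← exp_sum, ← exp_add]
  congr 1
  rw [add_mul, neg_add, Finset.sum_mul, ← Finset.sum_neg_distrib]
  congr 1
  exact Finset.sum_congr rfl fun j _ => by ring

/-- The Barnes zeta function exists if all parameters lie in the right half-plane. -/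
theorem hasBarnesZeta_of_re_pos (hz : 0 < z.re) (hω : ∀ j, 0 < (ω j).re) : HasBarnesZeta z ω := by
  obtain ⟨c, hc⟩ := barnesKernel_expansion (z := z) hω
  have hcont := continuousOn_barnesKernel (z := z) hω
  have htop := barnesKernel_isBigO_atTop (z := z) hω
  have hΓ : Differentiable ℂ fun s : ℂ => (Gamma s)⁻¹ := differentiable_one_div_Gamma
  have hd : DifferentiableOn ℂ (mellin (barnesKernel z ω)) {s | (r : ℝ) < s.re} := fun s hs => by
    refine (mellin_differentiableAt_of_isBigO_rpow_exp hz
      (hcont.locallyIntegrableOn measurableSet_Ioi) htop (b := r) ?_ hs).differentiableWithinAt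
    -- The empty expansion N = 0 says that the kernel is O(t^(−r)) at 0.
    simpa using hc 0
  obtain ⟨F, hF, hFs⟩ := exists_meromorphicNFOn_of_halfPlanes
    (hΓ.differentiableOn.mul hd) (c := r) fun N => by
      obtain ⟨F, hF, hFs⟩ := exists_meromorphicOn_mellin hz hcont htop c (hc N)
      refine ⟨fun s => (Gamma s)⁻¹ * F s, fun s hs => ?_, fun s hs => by simp [hFs s hs]⟩
      exact (hΓ.analyticAt s).meromorphicAt.mul (hF s hs)
  refine ⟨F, hF, fun s hs => ?_⟩
  have hs0 : 0 < s.re := (Nat.cast_nonneg r).trans_lt hs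
  have h := hasSum_mellin_cexp (p := fun m : Fin r → ℕ => z + ∑ j, (m j : ℂ) * ω j)
    (add_sum_re_pos hz hω) hs0 (fun t ht => hasSum_barnesKernel hω ht)
    (by simpa only [add_sum_re] using summable_add_sum_rpow hz hω hs)
  rw [hFs s hs]
  refine (h.mul_left (Gamma s)⁻¹).congr_fun fun m => ?_
  rw [← mul_div_assoc, inv_mul_cancel₀ (Gamma_ne_zero_of_re_pos hs0)]

end Kernel

/-- Both arg a and arg(aw) lie in (−π/2, π/2), so arg(aw) and arg a + arg w differ by less than 2π;
being congruent mod 2π, they are equal. -/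
theorem log_mul_of_re_pos {a w : ℂ} (ha : 0 < a.re) (h : 0 < (a * w).re) :
    log (a * w) = log a + log w := by
  have ha0 : a ≠ 0 := by rintro rfl; simp at ha
  have hw0 : w ≠ 0 := by rintro rfl; simp at h
  refine log_mul ha0 hw0 ?_
  have h1 := abs_lt.1 (abs_arg_lt_pi_div_two_iff.2 (Or.inl ha))
  have h2 := abs_lt.1 (abs_arg_lt_pi_div_two_iff.2 (Or.inl h))
  have h3 := arg_le_pi w
  have h4 := neg_pi_lt_arg w
  have h5 : ((arg (a * w) : ℝ) : Real.Angle) = ((arg a + arg w : ℝ) : Real.Angle) := by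
    rw [Real.Angle.coe_add]
    exact arg_mul_coe_angle ha0 hw0
  obtain ⟨k, hk⟩ := Real.Angle.angle_eq_iff_two_pi_dvd_sub.1 h5
  have hπ := Real.pi_pos
  have hk1 : (-1 : ℝ) < k := by nlinarith
  have hk2 : (k : ℝ) < 1 := by nlinarith
  have hk0 : k = 0 := by
    have a1 : (-1 : ℤ) < k := by exact_mod_cast hk1
    have a2 : k < 1 := by exact_mod_cast hk2
    omega
  rw [hk0] at hk
  simp at hk
  constructor <;> linarith

theorem cpow_mul_of_re_pos {a w : ℂ} (ha : 0 < a.re) (h : 0 < (a * w).re) (s : ℂ) :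
    (a * w) ^ s = a ^ s * w ^ s := by
  have ha0 : a ≠ 0 := by rintro rfl; simp at ha
  have hw0 : w ≠ 0 := by rintro rfl; simp at h
  rw [cpow_def_of_ne_zero (mul_ne_zero ha0 hw0), cpow_def_of_ne_zero ha0, cpow_def_of_ne_zero hw0,
    log_mul_of_re_pos ha h, add_mul, exp_add]

/-- The Barnes zeta function exists if `1` and all parameters lie in an open half-plane. -/
theorem hasBarnesZeta_of_halfPlane {r : ℕ} {z : ℂ} {ω : Fin r → ℂ} {a : ℂ} (ha : 0 < a.re)
    (hz : 0 < (a * z).re) (hω : ∀ j, 0 < (a * ω j).re) : HasBarnesZeta z ω := by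
  have ha0 : a ≠ 0 := by rintro rfl; simp at ha
  obtain ⟨F, hF, hFs⟩ := hasBarnesZeta_of_re_pos hz hω
  have hd : Differentiable ℂ fun s : ℂ => a ^ s := fun s => by
    exact (differentiableAt_id.const_cpow (Or.inl ha0))
  -- By homogeneity, a^s ζ_r(s, az ∣ aω) is the required function; the factor a^s is entire without
  -- zeros and preserves the normal form.
  refine ⟨fun s => a ^ s * F s, ?_, fun s hs => ?_⟩
  · refine (meromorphicNFOn_mul_iff_right_of_analyticOnNhd
      (analyticOnNhd_univ_iff_differentiable.2 hd) fun s _ => ?_).2 hF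
    simp [cpow_eq_zero_iff, ha0]
  · refine ((hFs s hs).mul_left (a ^ s)).congr_fun fun m => ?_
    have h1 : a * z + ∑ j, (m j : ℂ) * (a * ω j) = a * (z + ∑ j, (m j : ℂ) * ω j) := by
      rw [mul_add, Finset.mul_sum]
      congr 1
      exact Finset.sum_congr rfl fun j _ => by ring
    have h2 := add_sum_re_pos (ω := fun j => a * ω j) hz hω m
    rw [h1] at h2 ⊢
    rw [cpow_mul_of_re_pos ha h2, mul_one_div, mul_comm, div_mul_cancel_right₀, one_div]
    simp [cpow_eq_zero_iff, ha0]

/-! ### Convergence of the Fourier series -/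

theorem summable_pnat_pow_mul_exp (k : ℕ) {c : ℝ} (hc : 0 < c) :
    Summable fun n : ℕ+ => ((n : ℕ) : ℝ) ^ k * Real.exp (-c * (n : ℕ)) :=
  (Real.summable_pow_mul_exp_neg_nat_mul k hc).comp_injective PNat.coe_injective

theorem norm_pnat_cpow_le {s : ℂ} {k : ℕ} (h : s.re ≤ k) (n : ℕ+) :
    ‖(n : ℂ) ^ s‖ ≤ ((n : ℕ) : ℝ) ^ k := by
  rw [norm_natCast_cpow_of_pos n.pos, ← Real.rpow_natCast]
  exact Real.rpow_le_rpow_of_exponent_le (by exact_mod_cast n.pos) h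

/-- The terms of the Fourier expansion of a bilateral sum. -/
def bilateralTerm {r : ℕ} (a : ℂ) (b : Fin r → ℂ) (s : ℂ) (n : ℕ+) : ℂ :=
  (n : ℂ) ^ (s - 1) * barnesKernel a b (n : ℕ)

section BilateralTerm

variable {r : ℕ} {a : ℂ} {b : Fin r → ℂ}

theorem norm_barnesKernel_nat_le (hb : ∀ j, 0 < (b j).re) (n : ℕ+) :
    ‖barnesKernel a b (n : ℕ)‖ ≤
      (∏ j, (1 - Real.exp (-(b j).re))⁻¹) * Real.exp (-a.re * (n : ℕ)) := by
  rw [barnesKernel, norm_mul, mul_comm, norm_prod]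
  have hn : (1 : ℝ) ≤ (n : ℕ) := by exact_mod_cast n.pos
  refine mul_le_mul (Finset.prod_le_prod (fun j _ => norm_nonneg _) fun j _ => ?_) ?_
    (norm_nonneg _) (Finset.prod_nonneg fun j _ => ?_)
  · rw [norm_inv]
    have h1 : Real.exp (-(b j).re) < 1 := by
      rw [Real.exp_lt_one_iff]
      linarith [hb j]
    refine inv_anti₀ (by linarith) ?_
    have h2 : ‖exp (-(b j * ((n : ℕ) : ℝ)))‖ ≤ Real.exp (-(b j).re) := by
      rw [norm_exp]
      have := hb j
      simp
      nlinarith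
    have h3 := norm_sub_norm_le 1 (exp (-(b j * ((n : ℕ) : ℝ))))
    rw [norm_one] at h3
    linarith
  · rw [norm_exp]
    simp
  · have h1 : Real.exp (-(b j).re) < 1 := by
      rw [Real.exp_lt_one_iff]
      linarith [hb j]
    exact inv_nonneg.2 (by linarith)

/-- One majorant n^k e^(−n Re a), up to a constant, with k ≥ R serves the whole half-plane Re s < R,
since the geometric factors are bounded uniformly in n ≥ 1. It yields both summability and
holomorphy in s. -/
theorem exists_summable_bound_bilateralTerm (ha : 0 < a.re) (hb : ∀ j, 0 < (b j).re) (R : ℝ) :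
    ∃ u : ℕ+ → ℝ, Summable u ∧
      ∀ (n : ℕ+) (s : ℂ), s.re < R → ‖bilateralTerm a b s n‖ ≤ u n := by
  obtain ⟨k, hk⟩ := exists_nat_ge R
  refine ⟨_, (summable_pnat_pow_mul_exp k ha).mul_left (∏ j, (1 - Real.exp (-(b j).re))⁻¹),
    fun n s hs => ?_⟩
  rw [bilateralTerm, norm_mul, mul_left_comm]
  refine mul_le_mul (norm_pnat_cpow_le ?_ n) (norm_barnesKernel_nat_le hb n) (norm_nonneg _)
    (by positivity)
  simp
  linarith

theorem summable_bilateralTerm (ha : 0 < a.re) (hb : ∀ j, 0 < (b j).re) (s : ℂ) :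
    Summable (bilateralTerm a b s) := by
  obtain ⟨u, hu, h⟩ := exists_summable_bound_bilateralTerm ha hb (s.re + 1)
  exact Summable.of_norm_bounded hu fun n => h n s (by linarith)

theorem differentiable_tsum_bilateralTerm (ha : 0 < a.re) (hb : ∀ j, 0 < (b j).re) :
    Differentiable ℂ fun s => ∑' n, bilateralTerm a b s n := by
  intro s
  obtain ⟨u, hu, h⟩ := exists_summable_bound_bilateralTerm ha hb (s.re + 1)
  have hopen : IsOpen {t : ℂ | t.re < s.re + 1} := isOpen_lt continuous_re continuous_const
  refine (differentiableOn_tsum_of_summable_norm hu (fun n => ?_) hopen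
    fun n t ht => h n t ht).differentiableAt (hopen.mem_nhds (by simp))
  have hn : ((n : ℕ) : ℂ) ≠ 0 := Nat.cast_ne_zero.2 n.ne_zero
  refine Differentiable.differentiableOn fun t => ?_
  exact ((differentiableAt_id.sub_const 1).const_cpow (Or.inl hn)).mul_const _

/-- Expanding the geometric series in a Fourier expansion and interchanging the summations. -/
theorem hasSum_tsum_cpow_mul_exp (ha : 0 < a.re) (hb : ∀ j, 0 < (b j).re) (s : ℂ) :
    HasSum (fun m : Fin r → ℕ => ∑' n : ℕ+,
      (n : ℂ) ^ (s - 1) * exp (-((a + ∑ j, (m j : ℂ) * b j) * (n : ℕ))))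
      (∑' n, bilateralTerm a b s n) := by
  set T : (Fin r → ℕ) × ℕ+ → ℂ := fun q =>
    (q.2 : ℂ) ^ (s - 1) * exp (-((a + ∑ j, (q.1 j : ℂ) * b j) * (q.2 : ℕ))) with hT
  obtain ⟨k, hk⟩ := exists_nat_ge (s - 1).re
  have hgeo : Summable fun m : Fin r → ℕ => Real.exp (-∑ j, (m j : ℝ) * (b j).re) := by
    refine (hasSum_prod_geometric (x := fun j => exp (-(b j)))
      fun j => by simpa using norm_exp_neg_mul_lt_one (hb j) one_pos).1.congr fun m => ?_
    simp only [← exp_nat_mul, ← exp_sum, norm_exp]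
    congr 1
    simp
  have hTs : Summable T := by
    -- Since n ≥ 1, e^(−n Σ m_j Re b_j) ≤ e^(−Σ m_j Re b_j): the double series is majorised by a
    -- product of a series in m and one in n.
    refine Summable.of_norm_bounded
      (hgeo.mul_of_nonneg (summable_pnat_pow_mul_exp k ha) (fun _ => by positivity)
        fun _ => by positivity) fun q => ?_
    rw [hT, norm_mul, mul_left_comm]
    refine mul_le_mul (norm_pnat_cpow_le hk _) ?_ (norm_nonneg _) (by positivity)
    rw [norm_exp, ← Real.exp_add]
    refine Real.exp_le_exp.2 ?_
    have h0 : 0 ≤ ∑ j, (q.1 j : ℝ) * (b j).re :=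
      Finset.sum_nonneg fun j _ => mul_nonneg (Nat.cast_nonneg _) (hb j).le
    have hn : (1 : ℝ) ≤ (q.2 : ℕ) := by exact_mod_cast q.2.pos
    have : (-((a + ∑ j, (q.1 j : ℂ) * b j) * ((q.2 : ℕ) : ℂ))).re =
        -((a.re + ∑ j, (q.1 j : ℝ) * (b j).re) * (q.2 : ℕ)) := by
      rw [← add_sum_re]
      simp
    rw [this]
    nlinarith
  have h1 : ∀ m, HasSum (fun n => T (m, n)) (∑' n, T (m, n)) := fun m => (hTs.prod_factor m).hasSum
  have h2 := hTs.hasSum.prod_fiberwise h1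
  have h3 : HasSum (fun n => bilateralTerm a b s n) (∑' q, T q) := by
    refine ((Equiv.prodComm _ _).hasSum_iff.2 hTs.hasSum).prod_fiberwise fun n => ?_
    have := (hasSum_barnesKernel (z := a) hb (t := (n : ℕ))
      (by exact_mod_cast n.pos)).mul_left ((n : ℂ) ^ (s - 1))
    simpa [hT, Function.comp_def, bilateralTerm] using this
  rw [h3.tsum_eq]
  exact h2

end BilateralTerm

/-! ### Lipschitz formula -/

/-- The Lipschitz summation formula. -/
theorem tsum_lipschitz {a s : ℂ} (ha : 0 < a.re) (hs : 1 < s.re)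
    (hsum : Summable fun m : ℤ => 1 / (a + 2 * Real.pi * I * m) ^ s) :
    ∑' m : ℤ, 1 / (a + 2 * Real.pi * I * m) ^ s =
      (Gamma s)⁻¹ * ∑' n : ℕ+, (n : ℂ) ^ (s - 1) * exp (-(a * (n : ℕ))) := by
  have hs0 : 0 < s.re := by linarith
  have hΓ := Gamma_ne_zero_of_re_pos hs0
  have hs1 : 0 < (s - 1).re := by simpa using hs
  have hs1' : s - 1 ≠ 0 := fun h => by simp [h] at hs1
  -- Poisson summation is applied to t^(s−1) e^(−at) extended by 0 to t ≤ 0. The extension is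
  -- continuous because Re s > 1, and its Fourier transform at m is Γ(s)/(a + 2πim)^s.
  set f : ℝ → ℂ := fun t => ((max t 0 : ℝ) : ℂ) ^ (s - 1) * exp (-(a * t)) with hf
  have hneg : ∀ t ≤ 0, f t = 0 := fun t ht => by simp [hf, max_eq_right ht, zero_cpow hs1']
  have hcont : Continuous f :=
    ((continuous_ofReal_cpow_const hs1).comp (continuous_id.max continuous_const)).mul
      (by fun_prop)
  have hF : ∀ m : ℤ, FourierTransform.fourier f (m : ℝ) =
      Gamma s * (1 / (a + 2 * Real.pi * I * m) ^ s) := fun m => by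
    have hre : 0 < (a + 2 * Real.pi * I * m).re := by simpa using ha
    rw [Real.fourier_real_eq_integral_exp_smul, mul_one_div, ← integral_cpow_mul_cexp hs0 hre,
      ← setIntegral_eq_integral_of_forall_compl_eq_zero (s := Ioi 0)]
    · refine setIntegral_congr_fun measurableSet_Ioi fun t ht => ?_
      simp only [hf, smul_eq_mul, max_eq_left (le_of_lt (mem_Ioi.1 ht))]
      rw [mul_left_comm, ← exp_add]
      congr 2
      push_cast
      ring
    · intro t ht
      rw [hneg t (not_lt.1 ht), smul_zero]
  have hdecay : f =O[cocompact ℝ] (|·| ^ (-2 : ℝ)) := by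
    rw [cocompact_eq_atBot_atTop]
    refine IsBigO.sup ?_ ?_
    · refine (isBigO_zero _ _).congr' ?_ EventuallyEq.rfl
      filter_upwards [eventually_le_atBot 0] with t ht
      rw [hneg t ht]
    · have h1 := (isLittleO_exp_neg_mul_rpow_atTop ha (-2 - (s - 1).re)).isBigO
      have h2 := (isBigO_refl (fun t : ℝ => t ^ (s - 1).re) atTop).mul h1
      refine IsBigO.congr' (IsBigO.trans (IsBigO.of_norm_eventuallyLE ?_) h2)
        EventuallyEq.rfl ?_
      · filter_upwards [eventually_gt_atTop 0] with t ht
        simp only [hf, max_eq_left ht.le]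
        rw [norm_cpow_mul_exp ht]
      · filter_upwards [eventually_gt_atTop 0] with t ht
        rw [abs_of_pos ht, ← Real.rpow_add ht]
        congr 1
        ring
  have hP := Real.tsum_eq_tsum_fourier_of_rpow_decay_of_summable hcont one_lt_two hdecay
    (by simpa only [hF] using hsum.mul_left _) 0
  have hQ : ∑' n : ℤ, f (0 + n) = ∑' n : ℕ+, (n : ℂ) ^ (s - 1) * exp (-(a * (n : ℕ))) := by
    have hinj : Function.Injective fun n : ℕ+ => ((n : ℕ) : ℤ) :=
      Nat.cast_injective.comp PNat.coe_injective
    rw [← hinj.tsum_eq]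
    · refine tsum_congr fun n => ?_
      simp [hf]
    · intro n hn
      have hn0 : 0 < n := by
        by_contra h
        refine hn (hneg _ ?_)
        simpa using h
      exact ⟨⟨n.toNat, by omega⟩, by simp [hn0.le]⟩
  rw [hQ] at hP
  have hz : ((0 : ℝ) : UnitAddCircle) = 0 := rfl
  simp only [hF, hz, fourier_eval_zero, mul_one, tsum_mul_left] at hP
  rw [hP, inv_mul_cancel_left₀ hΓ]

/-! ### The bilateral zeta function and its Fourier expansion -/

/-- Points of an open half-plane bounded by the line `ℝ c`, together with one of its boundary rays,
lie in a common open half-plane. -/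
theorem exists_halfPlane {r : ℕ} {w c : ℂ} {p : Fin r → ℂ} (hc : 0 < c.im) (hw : (w / c).im < 0)
    (hp : ∀ j, (p j / c).im < 0) (σ : ℝ) (hσ : σ ≠ 0) :
    ∃ a : ℂ, 0 < a.re ∧ 0 < (a * w).re ∧ (∀ j, 0 < (a * p j).re) ∧ 0 < σ * (a * c).re := by
  have hc0 : c ≠ 0 := by rintro rfl; simp at hc
  -- Multiplication by i/c makes the real parts of 1, w and the p_j positive but sends c to i.
  -- Adding a small εσ/c tilts c to the side given by the sign of σ and keeps the finitely many
  -- strict inequalities.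
  have key : ∀ x : ℂ, (x / c).im < 0 →
      ∀ᶠ ε : ℝ in 𝓝[>] 0, 0 < ((I + ε * σ) / c * x).re := by
    intro x hx
    refine Eventually.filter_mono nhdsWithin_le_nhds ?_
    have hcont : Continuous fun ε : ℝ => ((I + ε * σ) / c * x).re := by fun_prop
    refine (hcont.tendsto 0).eventually (eventually_gt_nhds ?_)
    have : (I + ((0 : ℝ) : ℂ) * σ) / c * x = I * (x / c) := by
      simp
      ring
    rw [this]
    simpa using hx
  have h1 : ((1 : ℂ) / c).im < 0 := by
    rw [one_div, inv_im]
    have := normSq_pos.2 hc0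
    exact div_neg_of_neg_of_pos (by linarith) this
  obtain ⟨ε, h1, h2, h3, hε⟩ := ((key 1 h1).and ((key w hw).and
    ((eventually_all.2 fun j => key (p j) (hp j)).and self_mem_nhdsWithin))).exists
  refine ⟨(I + ε * σ) / c, by simpa using h1, h2, h3, ?_⟩
  rw [div_mul_cancel₀ _ hc0]
  have : (0 : ℝ) < ε := hε
  have h4 : 0 < σ * σ := mul_self_pos.2 hσ
  simp
  nlinarith

theorem hasBilateralZeta_of_im_neg {r : ℕ} {w c : ℂ} {p : Fin r → ℂ} (hc : 0 < c.im)
    (hw : (w / c).im < 0) (hp : ∀ j, (p j / c).im < 0) : HasBilateralZeta w c p := by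
  obtain ⟨a, ha, haw, hap, hac⟩ := exists_halfPlane hc hw hp 1 (by norm_num)
  obtain ⟨a', ha', haw', hap', hac'⟩ := exists_halfPlane hc hw hp (-1) (by norm_num)
  rw [one_mul] at hac
  refine ⟨hasBarnesZeta_of_halfPlane ha ?_ (Fin.cases ?_ fun j => ?_),
    hasBarnesZeta_of_halfPlane ha' haw' (Fin.cases ?_ fun j => ?_)⟩
  · rw [mul_add, add_re]
    exact add_pos haw hac
  · simpa using hac
  · simpa using hap j
  · simpa using hac'
  · simpa using hap' j

/-- The arguments lie in [0, π] and (−π, 0), so their sum stays in (−π, π]. -/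
theorem cpow_mul_of_im_neg {c v : ℂ} (hc : 0 < c.im) (hv : v.im < 0) (s : ℂ) :
    (c * v) ^ s = c ^ s * v ^ s := by
  have hc0 : c ≠ 0 := by rintro rfl; simp at hc
  have hv0 : v ≠ 0 := by rintro rfl; simp at hv
  have h1 := arg_neg_iff.2 hv
  have h2 := arg_nonneg_iff.2 hc.le
  have h3 := arg_le_pi c
  have h4 := neg_pi_lt_arg v
  rw [cpow_def_of_ne_zero (mul_ne_zero hc0 hv0), cpow_def_of_ne_zero hc0, cpow_def_of_ne_zero hv0,
    log_mul hc0 hv0 ⟨by linarith, by linarith⟩, add_mul, exp_add]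

theorem two_pi_I_cpow (s : ℂ) :
    (2 * Real.pi * I : ℂ) ^ s = exp (Real.pi / 2 * I * s) * (2 * Real.pi : ℂ) ^ s := by
  have hπ : (0 : ℝ) < 2 * Real.pi := by positivity
  have hπ' : (2 * Real.pi : ℂ) ≠ 0 := by exact_mod_cast hπ.ne'
  have h : log (2 * Real.pi * I : ℂ) = log (2 * Real.pi : ℂ) + Real.pi / 2 * I := by
    have h1 := log_ofReal_mul hπ I_ne_zero
    push_cast at h1
    rw [h1, log_I, ofReal_log hπ.le]
    push_cast
    rfl
  rw [cpow_def_of_ne_zero (mul_ne_zero hπ' I_ne_zero), cpow_def_of_ne_zero hπ', h, add_mul,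
    exp_add, mul_comm]

theorem barnesZeta_spec {r : ℕ} {z : ℂ} {ω : Fin r → ℂ} (h : HasBarnesZeta z ω) :
    IsBarnesZeta z ω (barnesZeta z ω) := by
  rw [barnesZeta, dif_pos h]
  exact Classical.choose_spec h

theorem IsBarnesZeta.barnesZeta_eq {r : ℕ} {z : ℂ} {ω : Fin r → ℂ} {F : ℂ → ℂ}
    (h : IsBarnesZeta z ω F) : barnesZeta z ω = F :=
  (barnesZeta_spec ⟨F, h⟩).unique h

/-- The entire function given by the Fourier expansion of the bilateral zeta function. -/
def bilateralSeries {r : ℕ} (w c : ℂ) (p : Fin r → ℂ) (s : ℂ) : ℂ :=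
  exp (Real.pi / 2 * I * s) * (2 * Real.pi : ℂ) ^ s / Gamma s * (c ^ (-s) *
    ∑' n, bilateralTerm (2 * Real.pi * I * (w / c)) (fun j => 2 * Real.pi * I * (p j / c)) s n)

section Bilateral

variable {r : ℕ} {w c : ℂ} {p : Fin r → ℂ}

theorem two_pi_I_mul_re_pos {v : ℂ} (hv : v.im < 0) : 0 < (2 * Real.pi * I * v).re := by
  have : (2 * Real.pi * I * v).re = 2 * Real.pi * -v.im := by simp
  rw [this]
  have := Real.pi_pos
  have : 0 < -v.im := by linarith
  positivity

theorem differentiable_bilateralSeries (hc : 0 < c.im) (hw : (w / c).im < 0)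
    (hp : ∀ j, (p j / c).im < 0) : Differentiable ℂ (bilateralSeries w c p) := by
  have hc0 : c ≠ 0 := by rintro rfl; simp at hc
  have hπ : (2 * Real.pi : ℂ) ≠ 0 := by simp [Real.pi_ne_zero]
  have h1 : Differentiable ℂ fun s : ℂ => (2 * Real.pi : ℂ) ^ s := fun s =>
    differentiableAt_id.const_cpow (Or.inl hπ)
  have h2 : Differentiable ℂ fun s : ℂ => c ^ (-s) := fun s =>
    differentiableAt_id.neg.const_cpow (Or.inl hc0)
  have h3 := differentiable_tsum_bilateralTerm (two_pi_I_mul_re_pos hw)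
    fun j => two_pi_I_mul_re_pos (hp j)
  have h4 : Differentiable ℂ fun s : ℂ => exp (Real.pi / 2 * I * s) := by fun_prop
  -- `Gamma` takes the value 0 at its poles, so division by it gives 0 there, as the entire function
  -- 1/Γ does.
  exact ((h4.mul h1).mul differentiable_one_div_Gamma).mul (h2.mul h3)

theorem add_sum_div_im_neg (hw : (w / c).im < 0) (hp : ∀ j, (p j / c).im < 0) (m : Fin r → ℕ) :
    ((w + ∑ j, (m j : ℂ) * p j) / c).im < 0 := by
  have h : ((w + ∑ j, (m j : ℂ) * p j) / c).im = (w / c).im + ∑ j, (m j : ℝ) * (p j / c).im := by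
    rw [add_div, add_im, Finset.sum_div, im_sum]
    simp [mul_div_assoc]
  rw [h]
  have : ∑ j, (m j : ℝ) * (p j / c).im ≤ 0 :=
    Finset.sum_nonpos fun j _ => mul_nonpos_of_nonneg_of_nonpos (Nat.cast_nonneg _) (hp j).le
  linarith

/-- A sum over a full line of lattice points. -/
theorem tsum_int_one_div_cpow {u s : ℂ} (hc : 0 < c.im) (hu : (u / c).im < 0) (hs : 1 < s.re)
    (hsum : Summable fun i : ℤ => 1 / (u + i * c) ^ s) :
    ∑' i : ℤ, 1 / (u + i * c) ^ s =
      exp (Real.pi / 2 * I * s) * (2 * Real.pi : ℂ) ^ s / Gamma s * (c ^ (-s) *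
        ∑' n : ℕ+, (n : ℂ) ^ (s - 1) * exp (-(2 * Real.pi * I * (u / c) * (n : ℕ)))) := by
  have hc0 : c ≠ 0 := by rintro rfl; simp at hc
  have h2π : (0 : ℝ) < 2 * Real.pi := by positivity
  have hI : 0 < (2 * Real.pi * I : ℂ).im := by simpa using h2π
  have hI0 : (2 * Real.pi * I : ℂ) ≠ 0 := fun h => by simp [h] at hI
  have hIs : (2 * Real.pi * I : ℂ) ^ s ≠ 0 := by simp [cpow_eq_zero_iff, hI0]
  have hcs : c ^ s ≠ 0 := by simp [cpow_eq_zero_iff, hc0]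
  -- Principal powers split because c and 2πi lie in the upper half-plane and u/c + i in the lower
  -- one.
  have hterm : ∀ i : ℤ, 1 / (2 * Real.pi * I * (u / c) + 2 * Real.pi * I * i) ^ s =
      c ^ s / (2 * Real.pi * I) ^ s * (1 / (u + i * c) ^ s) := fun i => by
    have hv : (u / c + i).im < 0 := by simpa using hu
    have h1 : u + i * c = c * (u / c + i) := by field_simp
    rw [h1, ← mul_add, cpow_mul_of_im_neg hI hv, cpow_mul_of_im_neg hc hv]
    field_simp
  have h := tsum_lipschitz (two_pi_I_mul_re_pos hu) hs
    (by simpa only [hterm] using hsum.mul_left _)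
  simp only [hterm, tsum_mul_left] at h
  rw [cpow_neg, ← two_pi_I_cpow]
  rw [div_mul_eq_mul_div, div_eq_iff hIs] at h
  rw [← mul_right_inj' hcs, h]
  field_simp

/-- The first zeta function sums over w + Σ m_j p_j + ic with i ≥ 1, because of its base point w +
c, and the second over i ≤ 0. Absolute convergence allows summing each full line over i ∈ ℤ first.
-/
theorem barnesZeta_add_barnesZeta (hc : 0 < c.im) (hw : (w / c).im < 0)
    (hp : ∀ j, (p j / c).im < 0) {s : ℂ} (hs : ((r + 1 : ℕ) : ℝ) < s.re) :
    barnesZeta (w + c) (Fin.cons c p : Fin (r + 1) → ℂ) s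
      + barnesZeta w (Fin.cons (-c) p : Fin (r + 1) → ℂ) s = bilateralSeries w c p s := by
  have hH := hasBilateralZeta_of_im_neg hc hw hp
  have hs1 : 1 < s.re := by
    push_cast at hs
    have : (0 : ℝ) ≤ r := Nat.cast_nonneg r
    linarith
  set h : ℤ → (Fin r → ℕ) → ℂ := fun i m => 1 / (w + ∑ j, (m j : ℂ) * p j + i * c) ^ s with hh
  have hA := (barnesZeta_spec hH.1).2 s hs
  have hB := (barnesZeta_spec hH.2).2 s hs
  rw [← (Fin.consEquiv (fun _ => ℕ)).hasSum_iff, ← (Equiv.prodComm _ _).hasSum_iff] at hA hB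
  have hA' : HasSum (fun q : (Fin r → ℕ) × ℕ => h (q.2 + 1) q.1)
      (barnesZeta (w + c) (Fin.cons c p : Fin (r + 1) → ℂ) s) := by
    refine hA.congr_fun fun q => ?_
    simp only [hh, Function.comp_apply, Fin.consEquiv, Equiv.prodComm_apply, Fin.sum_univ_succ]
    simp
    ring_nf
  have hB' : HasSum (fun q : (Fin r → ℕ) × ℕ => h (-q.2) q.1)
      (barnesZeta w (Fin.cons (-c) p : Fin (r + 1) → ℂ) s) := by
    refine hB.congr_fun fun q => ?_
    simp only [hh, Function.comp_apply, Fin.consEquiv, Equiv.prodComm_apply, Fin.sum_univ_succ]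
    simp
    ring_nf
  have hA1 := fun m => (hA'.summable.prod_factor m).hasSum
  have hB1 := fun m => (hB'.summable.prod_factor m).hasSum
  have hZ : ∀ m, HasSum (fun i : ℤ => h i m) (∑' n : ℕ, h (n + 1) m + ∑' n : ℕ, h (-n) m) := by
    intro m
    rw [add_comm, ← (Equiv.neg ℤ).hasSum_iff]
    refine HasSum.of_nat_of_neg_add_one (hB1 m) ?_
    simpa using hA1 m
  have hAB := (HasSum.prod_fiberwise hA' hA1).add (HasSum.prod_fiberwise hB' hB1)
  refine hAB.unique ?_
  have hL := (hasSum_tsum_cpow_mul_exp (two_pi_I_mul_re_pos hw)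
    (fun j => two_pi_I_mul_re_pos (hp j)) s).mul_left (c ^ (-s)) |>.mul_left
      (exp (Real.pi / 2 * I * s) * (2 * Real.pi : ℂ) ^ s / Gamma s)
  refine hL.congr_fun fun m => ?_
  rw [← (hZ m).tsum_eq, tsum_int_one_div_cpow hc (add_sum_div_im_neg hw hp m) hs1 (hZ m).summable]
  have hexp : 2 * Real.pi * I * ((w + ∑ j, (m j : ℂ) * p j) / c) =
      2 * Real.pi * I * (w / c) + ∑ j, (m j : ℂ) * (2 * Real.pi * I * (p j / c)) := by
    rw [add_div, mul_add (2 * (Real.pi : ℂ) * I), Finset.sum_div, Finset.mul_sum]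
    congr 1
    exact Finset.sum_congr rfl fun j _ => by ring
  rw [hexp]

/-- The Fourier expansion of the bilateral zeta function. -/
theorem bilateralZeta_eq_bilateralSeries (hc : 0 < c.im) (hw : (w / c).im < 0)
    (hp : ∀ j, (p j / c).im < 0) : bilateralZeta w c p = bilateralSeries w c p := by
  have hH := hasBilateralZeta_of_im_neg hc hw hp
  exact toMeromorphicNFOn_eq_of_eqOn_halfPlane
    ((barnesZeta_spec hH.1).1.meromorphicOn.add (barnesZeta_spec hH.2).1.meromorphicOn)
    (differentiable_bilateralSeries hc hw hp) fun s hs => barnesZeta_add_barnesZeta hc hw hp hs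

end Bilateral

/-! ### Reordering of parameters and telescoping -/

theorem IsBarnesZeta.comp_perm {r : ℕ} {z : ℂ} {ω : Fin r → ℂ} {F : ℂ → ℂ}
    (h : IsBarnesZeta z ω F) (σ : Equiv.Perm (Fin r)) : IsBarnesZeta z (ω ∘ σ) F := by
  refine ⟨h.1, fun s hs => ?_⟩
  rw [← (σ.arrowCongr (Equiv.refl ℕ)).symm.hasSum_iff]
  refine (h.2 s hs).congr_fun fun m => ?_
  simp only [Function.comp_apply]
  congr 3
  simpa [Equiv.arrowCongr] using Equiv.sum_comp σ fun j => (m j : ℂ) * ω j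

theorem hasBarnesZeta_comp_perm_iff {r : ℕ} {z : ℂ} {ω : Fin r → ℂ} (σ : Equiv.Perm (Fin r)) :
    HasBarnesZeta z (ω ∘ σ) ↔ HasBarnesZeta z ω := by
  refine ⟨fun ⟨F, hF⟩ => ⟨F, ?_⟩, fun ⟨F, hF⟩ => ⟨F, hF.comp_perm σ⟩⟩
  have := hF.comp_perm σ⁻¹
  rwa [Function.comp_assoc, ← Equiv.Perm.coe_mul, mul_inv_cancel, Equiv.Perm.coe_one,
    Function.comp_id] at this

theorem barnesZeta_comp_perm {r : ℕ} {z : ℂ} {ω : Fin r → ℂ} (σ : Equiv.Perm (Fin r)) :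
    barnesZeta z (ω ∘ σ) = barnesZeta z ω := by
  by_cases h : HasBarnesZeta z ω
  · exact ((barnesZeta_spec h).comp_perm σ).barnesZeta_eq
  · rw [barnesZeta, barnesZeta, dif_neg h, dif_neg (mt (hasBarnesZeta_comp_perm_iff σ).1 h)]

section Cones

variable {n : ℕ} (ω : Fin (n + 1) → ℂ)

/-- The vector `(ω₁, …, ω_k, -ω_{k+1}, …, -ω_r)`. -/
def flipFrom (k : ℕ) : Fin (n + 1) → ℂ := fun j => if (j : ℕ) < k then ω j else -ω j

/-- The partial sum `ω₁ + ⋯ + ω_k`. -/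
def partialSumLT (k : ℕ) : ℂ := ∑ j : Fin (n + 1), if (j : ℕ) < k then ω j else 0

theorem flipFrom_zero : flipFrom ω 0 = -ω := by
  funext j
  simp [flipFrom]

theorem flipFrom_last : flipFrom ω (n + 1) = ω := by
  funext j
  simp only [flipFrom, if_pos j.is_lt]

theorem partialSumLT_zero : partialSumLT ω 0 = 0 := by simp [partialSumLT]

theorem partialSumLT_last : partialSumLT ω (n + 1) = ∑ j, ω j := by
  simp only [partialSumLT, if_pos (Fin.is_lt _)]

theorem partialSumLT_coe (k : Fin (n + 1)) : partialSumLT ω k = ∑ j ∈ Finset.Iio k, ω j := by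
  rw [partialSumLT, ← Finset.sum_filter]
  congr 1
  ext j
  simp

theorem partialSumLT_succ (k : Fin (n + 1)) :
    partialSumLT ω (k + 1) = (∑ j ∈ Finset.Iio k, ω j) + ω k := by
  rw [← partialSumLT_coe, partialSumLT, partialSumLT, ← Fintype.sum_ite_eq k ω,
    ← Finset.sum_add_distrib]
  refine Finset.sum_congr rfl fun j _ => ?_
  rcases lt_trichotomy j k with h | rfl | h
  · simp [Fin.lt_def.1 h, (Fin.lt_def.1 h).trans (Nat.lt_succ_self _), h.ne']
  · simp
  · have := Fin.lt_def.1 h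
    simp [not_lt.2 this.le, h.ne, show ¬ (j : ℕ) < k + 1 by omega]

theorem sum_eq_add_sum_Ioi (k : Fin (n + 1)) :
    ∑ j, ω j = (∑ j ∈ Finset.Iio k, ω j) + ω k + ∑ j ∈ Finset.Ioi k, ω j := by
  have h : (Finset.univ : Finset (Fin (n + 1))) = insert k (Finset.Iio k) ∪ Finset.Ioi k := by
    ext j
    have := lt_trichotomy j k
    simp only [Finset.mem_univ, Finset.mem_union, Finset.mem_insert, Finset.mem_Iio,
      Finset.mem_Ioi, true_iff]
    tauto
  rw [h, Finset.sum_union, Finset.sum_insert (by simp), add_comm (ω k)]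
  rw [Finset.disjoint_left]
  intro j hj hj'
  simp only [Finset.mem_insert, Finset.mem_Iio, Finset.mem_Ioi] at hj hj'
  rcases hj with rfl | hj
  · exact lt_irrefl _ hj'
  · exact lt_asymm hj hj'

theorem cons_neg_removeNth (k : Fin (n + 1)) :
    (Fin.cons (-ω k) (k.removeNth (negFrom k ω)) : Fin (n + 1) → ℂ) =
      flipFrom ω k ∘ k.cycleRange.symm := by
  have h1 : negFrom k ω = flipFrom ω k := by
    funext j
    simp only [negFrom, flipFrom, Fin.le_def]
    split_ifs <;> first | rfl | omega
  rw [h1, ← Fin.cons_removeNth_eq_comp_cycleRange_symm]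
  simp [flipFrom]

/-- The sign vectors with thresholds k and k + 1 differ only in entry k, which is removed and put in
front with its own sign; the cycle restores the order. -/
theorem cons_removeNth (k : Fin (n + 1)) :
    (Fin.cons (ω k) (k.removeNth (negFrom k ω)) : Fin (n + 1) → ℂ) =
      flipFrom ω (k + 1) ∘ k.cycleRange.symm := by
  rw [← Fin.cons_removeNth_eq_comp_cycleRange_symm]
  have h1 : k.removeNth (negFrom k ω) = k.removeNth (flipFrom ω (k + 1)) := by
    funext j
    have h2 : ((k.succAbove j : Fin (n + 1)) : ℕ) ≠ k := fun h =>
      Fin.succAbove_ne k j (Fin.ext h)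
    simp only [Fin.removeNth, negFrom, flipFrom, Fin.le_def]
    split_ifs <;> first | rfl | omega
  rw [h1]
  simp [flipFrom]

/-- The Barnes zeta function of the `k`-th cone in the telescoping decomposition. -/
def coneZeta (w : ℂ) (k : ℕ) : ℂ → ℂ := barnesZeta (partialSumLT ω k - w) (flipFrom ω k)

variable {ω} {w : ℂ}

theorem barnesZeta_cons_neg_removeNth (k : Fin (n + 1)) :
    barnesZeta ((∑ j ∈ Finset.Iio k, ω j) - w)
      (Fin.cons (-ω k) (k.removeNth (negFrom k ω)) : Fin (n + 1) → ℂ) = coneZeta ω w k := by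
  rw [cons_neg_removeNth, barnesZeta_comp_perm, coneZeta, partialSumLT_coe]

theorem barnesZeta_cons_removeNth (k : Fin (n + 1)) :
    barnesZeta ((∑ j ∈ Finset.Iio k, ω j) - w + ω k)
      (Fin.cons (ω k) (k.removeNth (negFrom k ω)) : Fin (n + 1) → ℂ) = coneZeta ω w (k + 1) := by
  rw [cons_removeNth, barnesZeta_comp_perm, coneZeta, partialSumLT_succ, sub_add_eq_add_sub]

theorem sum_neg_one_pow_mul_add (S : ℕ → ℂ) (n : ℕ) :
    ∑ k : Fin (n + 1), (-1) ^ (k : ℕ) * (S (k + 1) + S k) = S 0 + (-1) ^ n * S (n + 1) := by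
  rw [Fin.sum_univ_eq_sum_range (fun k => (-1) ^ k * (S (k + 1) + S k))]
  induction n with
  | zero => simp [add_comm]
  | succ n ih =>
    rw [Finset.sum_range_succ, ih]
    ring

end Cones

/-! ### Decomposition of f₊ and f₋ -/

section Main

variable {n : ℕ} {ω : Fin (n + 1) → ℂ}

theorem im_div_eq_norm_mul_sin (x y : ℂ) :
    (x / y).im = ‖x‖ * ‖y‖ / normSq y * Real.sin (x.arg - y.arg) := by
  rw [Real.sin_sub, div_im]
  have h1 := norm_mul_cos_arg x
  have h2 := norm_mul_sin_arg x
  have h3 := norm_mul_cos_arg y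
  have h4 := norm_mul_sin_arg y
  nth_rewrite 1 [← h1, ← h2, ← h3, ← h4]
  ring

theorem im_div_pos_of_arg_lt {x y : ℂ} (hx : x ≠ 0) (hy : 0 < y.im) (h : y.arg < x.arg) :
    0 < (x / y).im := by
  have hy0 : y ≠ 0 := by rintro rfl; simp at hy
  rw [im_div_eq_norm_mul_sin]
  have h1 := norm_pos_iff.2 hx
  have h2 := norm_pos_iff.2 hy0
  have h3 := normSq_pos.2 hy0
  have h4 : 0 < y.arg := by
    refine lt_of_le_of_ne (arg_nonneg_iff.2 hy.le) fun h => ?_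
    exact hy.ne' (arg_eq_zero_iff.1 h.symm).2
  have h5 : 0 < Real.sin (x.arg - y.arg) :=
    Real.sin_pos_of_pos_of_lt_pi (by linarith) (by linarith [arg_le_pi x])
  positivity

theorem im_div_neg_of_arg_lt {x y : ℂ} (hx : 0 < x.arg) (hy : 0 < y.im) (h : x.arg < y.arg) :
    (x / y).im < 0 := by
  have hx0 : x ≠ 0 := by rintro rfl; simp at hx
  have hy0 : y ≠ 0 := by rintro rfl; simp at hy
  rw [im_div_eq_norm_mul_sin]
  have h1 := norm_pos_iff.2 hx0
  have h2 := norm_pos_iff.2 hy0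
  have h3 := normSq_pos.2 hy0
  have h5 : Real.sin (x.arg - y.arg) < 0 :=
    Real.sin_neg_of_neg_of_neg_pi_lt (by linarith) (by linarith [arg_le_pi y])
  exact mul_neg_of_pos_of_neg (by positivity) h5

theorem arg_pos_of_im_pos {x : ℂ} (hx : 0 < x.im) : 0 < x.arg :=
  lt_of_le_of_ne (arg_nonneg_iff.2 hx.le) fun h => hx.ne' (arg_eq_zero_iff.1 h.symm).2

variable (hω : ∀ k, 0 < (ω k).im) (horc : ∀ j k, j < k → (ω j).arg < (ω k).arg)

include hω horc

theorem im_div_neg_of_lt {j k : Fin (n + 1)} (h : j < k) : (ω j / ω k).im < 0 :=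
  im_div_neg_of_arg_lt (arg_pos_of_im_pos (hω j)) (hω k) (horc j k h)

theorem im_div_pos_of_lt {j k : Fin (n + 1)} (h : k < j) : 0 < (ω j / ω k).im :=
  im_div_pos_of_arg_lt (fun h0 => by simpa [h0] using hω j) (hω k) (horc k j h)

/-- The periods after ω_k in argument lie to the left of the line ℝω_k; their negation brings all
the others to its right. -/
theorem im_removeNth_div_neg (k : Fin (n + 1)) (j : Fin n) :
    (k.removeNth (negFrom k ω) j / ω k).im < 0 := by
  simp only [Fin.removeNth, negFrom]
  rcases lt_or_gt_of_ne (Fin.succAbove_ne k j) with h | h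
  · rw [if_neg (not_le.2 h)]
    exact im_div_neg_of_lt hω horc h
  · rw [if_pos h.le, neg_div, neg_im, neg_lt_zero]
    exact im_div_pos_of_lt hω horc h

theorem hasBilateralZeta_removeNth {w : ℂ} {k : Fin (n + 1)} (hw : (w / ω k).im < 0) :
    HasBilateralZeta w (ω k) (k.removeNth (negFrom k ω)) :=
  hasBilateralZeta_of_im_neg (hω k) hw (im_removeNth_div_neg hω horc k)

variable {w : ℂ} (hw : ∀ k, (((∑ j ∈ Finset.Iio k, ω j) - w) / ω k).im < 0)

include hw

/-- The end S_0 of the telescoping chain is one half of the first bilateral function; likewise S_r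
is one half of the last. -/
theorem hasBarnesZeta_neg : HasBarnesZeta (-w) (-ω) := by
  have h := (hasBilateralZeta_removeNth hω horc (hw 0)).2
  rw [cons_neg_removeNth, hasBarnesZeta_comp_perm_iff, ← partialSumLT_coe] at h
  simpa [flipFrom_zero, partialSumLT_zero] using h

theorem hasBarnesZeta_sum_sub : HasBarnesZeta ((∑ j, ω j) - w) ω := by
  have h := (hasBilateralZeta_removeNth hω horc (hw (Fin.last n))).1
  rw [cons_removeNth, hasBarnesZeta_comp_perm_iff, sub_add_eq_add_sub, ← partialSumLT_succ,
    Fin.val_last, flipFrom_last, partialSumLT_last] at h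
  exact h

/-- The decomposition of an alternating combination of two Barnes zeta functions into bilateral
ones, in the half-plane of convergence. -/
theorem barnesZeta_neg_add_barnesZeta {s : ℂ} (hs : ((n + 1 : ℕ) : ℝ) < s.re) :
    barnesZeta (-w) (-ω) s + (-1) ^ n * barnesZeta ((∑ j, ω j) - w) ω s =
      ∑ k : Fin (n + 1), (-1) ^ (k : ℕ) * bilateralSeries ((∑ j ∈ Finset.Iio k, ω j) - w) (ω k)
        (k.removeNth (negFrom k ω)) s := by
  have h := sum_neg_one_pow_mul_add (fun k => coneZeta ω w k s) n
  simp only [coneZeta, flipFrom_zero, partialSumLT_zero, flipFrom_last, partialSumLT_last,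
    zero_sub] at h
  rw [← h]
  refine Finset.sum_congr rfl fun k _ => ?_
  rw [← barnesZeta_add_barnesZeta (hω k) (hw k) (im_removeNth_div_neg hω horc k) hs,
    barnesZeta_cons_neg_removeNth, barnesZeta_cons_removeNth]
  rfl

theorem differentiable_sum_bilateralSeries (ε : Fin (n + 1) → ℂ) :
    Differentiable ℂ fun s => ∑ k : Fin (n + 1), ε k *
      bilateralSeries ((∑ j ∈ Finset.Iio k, ω j) - w) (ω k) (k.removeNth (negFrom k ω)) s :=
  Differentiable.fun_sum fun k _ => (differentiable_bilateralSeries (hω k) (hw k)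
    (im_removeNth_div_neg hω horc k)).const_mul _

theorem fPlus_eq_sum_bilateralSeries (s : ℂ) :
    fPlus w ω s =
      ∑ k : Fin (n + 1), (-1) ^ (k : ℕ) * bilateralSeries ((∑ j ∈ Finset.Iio k, ω j) - w) (ω k)
        (k.removeNth (negFrom k ω)) s := by
  refine congrFun (toMeromorphicNFOn_eq_of_eqOn_halfPlane (c := ((n + 1 : ℕ) : ℝ)) ?_
    (differentiable_sum_bilateralSeries hω horc hw fun k => (-1) ^ (k : ℕ)) fun s hs => ?_) s
  · have h1 := (barnesZeta_spec (hasBarnesZeta_neg hω horc hw)).1.meromorphicOn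
    have h2 := (barnesZeta_spec (hasBarnesZeta_sum_sub hω horc hw)).1.meromorphicOn
    exact h1.add (MeromorphicOn.mul (MeromorphicOn.const _) h2)
  · exact barnesZeta_neg_add_barnesZeta hω horc hw hs

/-- At |ω| − w the combination is (-1)^n times the one for f₊ at w, and (-1)^n (-1)^k = (-1)^(n−k).
-/
theorem fMinus_eq_sum_bilateralSeries (s : ℂ) :
    fMinus ((∑ j, ω j) - w) ω s =
      ∑ k : Fin (n + 1), (-1) ^ (n - (k : ℕ)) *
        bilateralSeries ((∑ j ∈ Finset.Iio k, ω j) - w) (ω k) (k.removeNth (negFrom k ω)) s := by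
  have hsub : (∑ j, ω j) - w - ∑ j, ω j = -w := by ring
  refine congrFun (toMeromorphicNFOn_eq_of_eqOn_halfPlane (c := ((n + 1 : ℕ) : ℝ)) ?_
    (differentiable_sum_bilateralSeries hω horc hw fun k => (-1) ^ (n - (k : ℕ))) fun s hs => ?_) s
  · have h1 := (barnesZeta_spec (hasBarnesZeta_neg hω horc hw)).1.meromorphicOn
    have h2 := (barnesZeta_spec (hasBarnesZeta_sum_sub hω horc hw)).1.meromorphicOn
    rw [hsub]
    exact h2.add (MeromorphicOn.mul (MeromorphicOn.const _) h1)
  · have h := congrArg ((-1) ^ n * ·) (barnesZeta_neg_add_barnesZeta hω horc hw hs)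
    have hsq : ((-1 : ℂ) ^ n) * (-1) ^ n = 1 := by
      rw [← mul_pow]
      simp
    simp only [mul_add, ← mul_assoc, hsq, one_mul, Finset.mul_sum] at h
    rw [hsub, Nat.add_sub_cancel, add_comm, h]
    refine Finset.sum_congr rfl fun k _ => ?_
    congr 1
    have hk : (-1 : ℂ) ^ n = (-1) ^ (n - (k : ℕ)) * (-1) ^ (k : ℕ) := by
      rw [← pow_add, Nat.sub_add_cancel (Nat.lt_succ_iff.1 k.2)]
    have hsq' : ((-1 : ℂ) ^ (k : ℕ)) * (-1) ^ (k : ℕ) = 1 := by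
      rw [← mul_pow]
      simp
    rw [hk, mul_assoc, hsq', mul_one]

end Main

/-! ### Matching the Fourier coefficients -/

section Terms

variable {n : ℕ} {ω : Fin (n + 1) → ℂ}

theorem exp_neg_two_pi_I_mul_sub_one (x : ℂ) (n : ℕ) :
    exp (-(2 * Real.pi * I * (x - 1) * n)) = exp (-(2 * Real.pi * I * x * n)) := by
  rw [exp_eq_exp_iff_exists_int]
  exact ⟨n, by push_cast; ring⟩

/-- Moving v by c multiplies the n-th exponential by e^(2πin) = 1. -/
theorem bilateralSeries_sub {r : ℕ} {c : ℂ} (hc : c ≠ 0) (v : ℂ) (p : Fin r → ℂ) :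
    bilateralSeries (v - c) c p = bilateralSeries v c p := by
  funext s
  have h : ∀ (b : Fin r → ℂ) (m : ℕ+), bilateralTerm (2 * Real.pi * I * ((v - c) / c)) b s m =
      bilateralTerm (2 * Real.pi * I * (v / c)) b s m := fun b m => by
    simp only [bilateralTerm, barnesKernel]
    rw [sub_div, div_self hc]
    congr 2
    exact_mod_cast exp_neg_two_pi_I_mul_sub_one (v / c) m
  simp only [bilateralSeries, h]

theorem prod_removeNth (k : Fin (n + 1)) (g : ℂ → ℂ) (f : Fin (n + 1) → ℂ) :
    ∏ j, g (k.removeNth f j) = ∏ j ∈ Finset.univ.erase k, g (f j) := by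
  have h : (Finset.univ.erase k : Finset (Fin (n + 1))) = Finset.univ.image k.succAbove := by
    rw [Fin.image_succAbove_univ]
    ext j
    simp
  rw [h, Finset.prod_image fun _ _ _ _ h => Fin.succAbove_right_injective h]
  rfl

theorem inv_one_sub_inv {x : ℂ} (hx : x ≠ 0) : (1 - x⁻¹)⁻¹ = -x * (1 - x)⁻¹ := by
  have h : 1 - x⁻¹ = -(x⁻¹ * (1 - x)) := by
    field_simp
    ring
  rw [h, inv_neg, mul_inv, inv_inv, neg_mul]

theorem prod_erase_ite (k : Fin (n + 1)) (A : Finset (Fin (n + 1))) (hA : k ∉ A)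
    (f g h : Fin (n + 1) → ℂ) (h1 : ∀ j ∈ A, f j = h j * g j) (h2 : ∀ j, j ≠ k → j ∉ A → f j = g j) :
    ∏ j ∈ Finset.univ.erase k, f j = (∏ j ∈ A, h j) * ∏ j ∈ Finset.univ.erase k, g j := by
  have hsub : A ⊆ Finset.univ.erase k := fun j hj => by
    simp only [Finset.mem_erase, Finset.mem_univ, and_true]
    rintro rfl
    exact hA hj
  rw [← Finset.prod_sdiff hsub, ← Finset.prod_sdiff hsub (f := g), Finset.prod_congr rfl h1,
    Finset.prod_mul_distrib]
  rw [Finset.prod_congr rfl fun j hj => h2 j (by simp at hj; exact hj.1) (by simp at hj; exact hj.2)]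
  ring

/-- For j < k the bilateral term contains (1 − x_j⁻¹)⁻¹ = −x_j (1 − x_j)⁻¹. These k factors produce
the sign (-1)^k, and the product of their x_j cancels the shift ω₁+⋯+ω_{k-1} in the exponential. -/
theorem fourierTerm_one_eq (w : ℂ) (s : ℂ) (k : Fin (n + 1)) (m : ℕ+) :
    fourierTerm 1 w ω s k m = (-1) ^ (k : ℕ) *
      bilateralTerm (2 * Real.pi * I * (((∑ j ∈ Finset.Iio k, ω j) - w) / ω k))
        (fun j => 2 * Real.pi * I * (k.removeNth (negFrom k ω) j / ω k)) s m := by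
  set x : Fin (n + 1) → ℂ := fun j => exp (2 * Real.pi * I * 1 * m * (ω j / ω k)) with hx
  have hx0 : ∀ j, x j ≠ 0 := fun j => exp_ne_zero _
  have hprod : ∏ j, (1 - exp (-(2 * Real.pi * I * (k.removeNth (negFrom k ω) j / ω k) *
      (((m : ℕ) : ℝ) : ℂ))))⁻¹ =
      (∏ j ∈ Finset.Iio k, -x j) * ∏ j ∈ Finset.univ.erase k, (1 - x j)⁻¹ := by
    rw [prod_removeNth k (fun y => (1 - exp (-(2 * Real.pi * I * (y / ω k) *
      (((m : ℕ) : ℝ) : ℂ))))⁻¹)]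
    refine prod_erase_ite k _ (by simp) _ _ _ (fun j hj => ?_) fun j hjk hj => ?_
    · have hj' : ¬ k ≤ j := by simpa using hj
      rw [← inv_one_sub_inv (hx0 j), negFrom, if_neg hj', hx, ← exp_neg]
      congr 4
      push_cast
      ring
    · have hj' : k ≤ j := by simpa using hj
      rw [negFrom, if_pos hj', hx]
      congr 3
      push_cast
      ring
  have hexp : exp (-(2 * Real.pi * I * (((∑ j ∈ Finset.Iio k, ω j) - w) / ω k) *
      (((m : ℕ) : ℝ) : ℂ))) * ∏ j ∈ Finset.Iio k, x j =
      exp (2 * Real.pi * I * 1 * m * (w / ω k)) := by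
    rw [hx, ← exp_sum, ← exp_add, ← Finset.mul_sum, ← Finset.sum_div]
    congr 1
    push_cast
    ring
  have hneg : ∏ j ∈ Finset.Iio k, -x j = (-1) ^ (k : ℕ) * ∏ j ∈ Finset.Iio k, x j := by
    rw [Finset.prod_neg, Fin.card_Iio]
  have hsq : ((-1 : ℂ) ^ (k : ℕ)) * (-1) ^ (k : ℕ) = 1 := by
    rw [← mul_pow]
    simp
  rw [fourierTerm, bilateralTerm, barnesKernel, hprod, hneg, ← hexp]
  linear_combination (-(m : ℂ) ^ (s - 1) * exp (-(2 * Real.pi * I *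
    (((∑ j ∈ Finset.Iio k, ω j) - w) / ω k) * (((m : ℕ) : ℝ) : ℂ))) * (∏ j ∈ Finset.Iio k, x j) *
      ∏ j ∈ Finset.univ.erase k, (1 - x j)⁻¹) * hsq

/-- The mirror image: now the n − k factors with j > k are inverted, and they absorb the shift by
the later periods. -/
theorem fourierTerm_neg_one_eq (z : ℂ) (s : ℂ) (k : Fin (n + 1)) (m : ℕ+) :
    fourierTerm (-1) z ω s k m = (-1) ^ (n - (k : ℕ)) *
      bilateralTerm (2 * Real.pi * I * ((z - ∑ j ∈ Finset.Ioi k, ω j) / ω k))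
        (fun j => 2 * Real.pi * I * (k.removeNth (negFrom k ω) j / ω k)) s m := by
  set x : Fin (n + 1) → ℂ := fun j => exp (2 * Real.pi * I * (-1) * m * (ω j / ω k)) with hx
  have hx0 : ∀ j, x j ≠ 0 := fun j => exp_ne_zero _
  have hprod : ∏ j, (1 - exp (-(2 * Real.pi * I * (k.removeNth (negFrom k ω) j / ω k) *
      (((m : ℕ) : ℝ) : ℂ))))⁻¹ =
      (∏ j ∈ Finset.Ioi k, -x j) * ∏ j ∈ Finset.univ.erase k, (1 - x j)⁻¹ := by
    rw [prod_removeNth k (fun y => (1 - exp (-(2 * Real.pi * I * (y / ω k) *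
      (((m : ℕ) : ℝ) : ℂ))))⁻¹)]
    refine prod_erase_ite k _ (by simp) _ _ _ (fun j hj => ?_) fun j hjk hj => ?_
    · have hj' : k < j := by simpa using hj
      rw [← inv_one_sub_inv (hx0 j), negFrom, if_pos hj'.le, hx, ← exp_neg]
      congr 4
      push_cast
      ring
    · have hj' : ¬ k ≤ j := fun h => hj (by simpa using lt_of_le_of_ne h (Ne.symm hjk))
      rw [negFrom, if_neg hj', hx]
      congr 3
      push_cast
      ring
  have hexp : exp (-(2 * Real.pi * I * ((z - ∑ j ∈ Finset.Ioi k, ω j) / ω k) *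
      (((m : ℕ) : ℝ) : ℂ))) * ∏ j ∈ Finset.Ioi k, x j =
      exp (2 * Real.pi * I * (-1) * m * (z / ω k)) := by
    rw [hx, ← exp_sum, ← exp_add, ← Finset.mul_sum, ← Finset.sum_div]
    congr 1
    push_cast
    ring
  have hneg : ∏ j ∈ Finset.Ioi k, -x j = (-1) ^ (n - (k : ℕ)) * ∏ j ∈ Finset.Ioi k, x j := by
    rw [Finset.prod_neg, Fin.card_Ioi]
    congr 2
  have hsq : ((-1 : ℂ) ^ (n - (k : ℕ))) * (-1) ^ (n - (k : ℕ)) = 1 := by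
    rw [← mul_pow]
    simp
  rw [fourierTerm, bilateralTerm, barnesKernel, hprod, hneg, ← hexp]
  linear_combination (-(m : ℂ) ^ (s - 1) * exp (-(2 * Real.pi * I *
    ((z - ∑ j ∈ Finset.Ioi k, ω j) / ω k) * (((m : ℕ) : ℝ) : ℂ))) * (∏ j ∈ Finset.Ioi k, x j) *
      ∏ j ∈ Finset.univ.erase k, (1 - x j)⁻¹) * hsq

end Terms

/-! ### Position of the base points -/

section Domains

variable {n : ℕ} {ω : Fin (n + 1) → ℂ} (hω : ∀ k, 0 < (ω k).im)
  (horc : ∀ j k, j < k → (ω j).arg < (ω k).arg)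

include hω horc

/-- The coefficient of ω_j is 1 − a_j > 0 for j < k and −a_j < 0 for j > k, opposite in sign to
Im(ω_j/ω_k), while j = k contributes 0. Strictness needs some j ≠ k, hence r ≥ 2. -/
theorem im_sub_parallelotope_neg (hn : 2 ≤ n + 1) {a : Fin (n + 1) → ℝ}
    (ha : ∀ k, 0 < a k ∧ a k < 1) (k : Fin (n + 1)) :
    (((∑ j ∈ Finset.Iio k, ω j) - ∑ j, (a j : ℂ) * ω j) / ω k).im < 0 := by
  have h1 : (((∑ j ∈ Finset.Iio k, ω j) - ∑ j, (a j : ℂ) * ω j) / ω k).im =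
      ∑ j : Fin (n + 1), ((if (j : ℕ) < k then 1 else 0) - a j) * (ω j / ω k).im := by
    rw [← partialSumLT_coe, partialSumLT, ← Finset.sum_sub_distrib, Finset.sum_div, im_sum]
    refine Finset.sum_congr rfl fun j _ => ?_
    rw [← im_ofReal_mul]
    congr 1
    split_ifs <;> push_cast <;> ring
  have h2 : ∀ j, j ≠ k → ((if (j : ℕ) < k then 1 else 0) - a j) * (ω j / ω k).im < 0 := by
    intro j hj
    rcases lt_or_gt_of_ne hj with h | h
    · rw [if_pos (Fin.lt_def.1 h)]
      exact mul_neg_of_pos_of_neg (by linarith [(ha j).2]) (im_div_neg_of_lt hω horc h)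
    · rw [if_neg (not_lt.2 (Fin.lt_def.1 h).le)]
      exact mul_neg_of_neg_of_pos (by linarith [(ha j).1]) (im_div_pos_of_lt hω horc h)
  have h3 : (ω k / ω k).im = 0 := by
    rw [div_self fun h0 => by simpa [h0] using hω k, one_im]
  rw [h1]
  have : Nontrivial (Fin (n + 1)) := Fin.nontrivial_iff_two_le.2 hn
  obtain ⟨j, hj⟩ := exists_ne k
  refine Finset.sum_neg' (fun i _ => ?_) ⟨j, Finset.mem_univ j, h2 j hj⟩
  rcases eq_or_ne i k with rfl | hi
  · simp [h3]
  · exact (h2 i hi).le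

theorem im_sub_neg_of_mem (hn : 2 ≤ n + 1) {z : ℂ} (hz : z ∈ domainD ω ∪ domainDPlus ω)
    (k : Fin (n + 1)) : (((∑ j ∈ Finset.Iio k, ω j) - z) / ω k).im < 0 := by
  rcases hz with ⟨-, a, ha, rfl⟩ | ⟨hz0, hz1, -⟩
  · exact im_sub_parallelotope_neg hω horc hn ha k
  · have h1 : 0 < (z / ω k).im := by
      refine im_div_pos_of_arg_lt hz0 (hω k) (lt_of_le_of_lt ?_ hz1)
      rcases (Fin.le_last k).lt_or_eq with h | rfl
      · exact (horc _ _ h).le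
      · exact le_rfl
    have h2 : ((∑ j ∈ Finset.Iio k, ω j) / ω k).im ≤ 0 := by
      rw [Finset.sum_div, im_sum]
      exact Finset.sum_nonpos fun j hj =>
        (im_div_neg_of_lt hω horc (Finset.mem_Iio.1 hj)).le
    rw [sub_div, sub_im]
    linarith

theorem im_sub_sum_Ioi_neg_of_mem (hn : 2 ≤ n + 1) {z : ℂ} (hz : z ∈ domainD ω ∪ domainDMinus ω)
    (k : Fin (n + 1)) : ((z - ∑ j ∈ Finset.Ioi k, ω j) / ω k).im < 0 := by
  rcases hz with ⟨-, a, ha, rfl⟩ | ⟨-, hz0, hz1⟩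
  · have h := im_sub_parallelotope_neg hω horc hn (a := fun j => 1 - a j)
      (fun j => ⟨by linarith [(ha j).2], by linarith [(ha j).1]⟩) k
    have hk0 : ω k ≠ 0 := fun h0 => by simpa [h0] using hω k
    have h1 : (∑ j ∈ Finset.Iio k, ω j) - ∑ j, ((1 - a j : ℝ) : ℂ) * ω j =
        ((∑ j, (a j : ℂ) * ω j) - ∑ j ∈ Finset.Ioi k, ω j) - ω k := by
      simp only [ofReal_sub, ofReal_one, sub_mul, one_mul, Finset.sum_sub_distrib]
      rw [sum_eq_add_sum_Ioi ω k]
      ring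
    rwa [h1, sub_div _ (ω k), div_self hk0, sub_im, one_im, sub_zero] at h
  · have h1 : (z / ω k).im < 0 := by
      refine im_div_neg_of_arg_lt hz0 (hω k) (lt_of_lt_of_le hz1 ?_)
      rcases (Fin.zero_le k).lt_or_eq with h | rfl
      · exact (horc _ _ h).le
      · exact le_rfl
    have h2 : 0 ≤ ((∑ j ∈ Finset.Ioi k, ω j) / ω k).im := by
      rw [Finset.sum_div, im_sum]
      exact Finset.sum_nonneg fun j hj =>
        (im_div_pos_of_lt hω horc (Finset.mem_Ioi.1 hj)).le
    rw [sub_div, sub_im]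
    linarith

end Domains

end BarnesZeta

/-! ### The main theorem -/

theorem theorem4p11 (n : ℕ) (hr : 2 ≤ n + 1) (ω : Fin (n + 1) → ℂ)
    (hω : ∀ k, 0 < (ω k).im)
    (horc : ∀ j k, j < k → (ω j).arg < (ω k).arg) :
    (∀ z ∈ domainD ω ∪ domainDPlus ω,
      HasBarnesZeta (-z) (-ω) ∧ HasBarnesZeta ((∑ j, ω j) - z) ω ∧
      (∀ k, HasBilateralZeta ((∑ j ∈ Finset.Iio k, ω j) - z) (ω k)
        (k.removeNth (negFrom k ω))) ∧
      ∀ s : ℂ,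
        fPlus z ω s =
          ∑ k : Fin (n + 1), (-1) ^ (k : ℕ) *
            bilateralZeta ((∑ j ∈ Finset.Iio k, ω j) - z) (ω k)
              (k.removeNth (negFrom k ω)) s ∧
        (∀ k, Summable (fourierTerm 1 z ω s k)) ∧
        fPlus z ω s =
          Complex.exp (Real.pi / 2 * Complex.I * s) * (2 * Real.pi : ℂ) ^ s / Complex.Gamma s *
            ∑ k : Fin (n + 1), ω k ^ (-s) * ∑' m : ℕ+, fourierTerm 1 z ω s k m) ∧
    (∀ z ∈ domainD ω ∪ domainDMinus ω,
      HasBarnesZeta z ω ∧ HasBarnesZeta (z - ∑ j, ω j) (-ω) ∧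
      (∀ k, HasBilateralZeta (z - ∑ j ∈ Finset.Ioi k, ω j) (ω k)
        (k.removeNth (negFrom k ω))) ∧
      ∀ s : ℂ,
        fMinus z ω s =
          ∑ k : Fin (n + 1), (-1) ^ (n - (k : ℕ)) *
            bilateralZeta (z - ∑ j ∈ Finset.Ioi k, ω j) (ω k)
              (k.removeNth (negFrom k ω)) s ∧
        (∀ k, Summable (fourierTerm (-1) z ω s k)) ∧
        fMinus z ω s =
          Complex.exp (Real.pi / 2 * Complex.I * s) * (2 * Real.pi : ℂ) ^ s / Complex.Gamma s *
            ∑ k : Fin (n + 1), ω k ^ (-s) * ∑' m : ℕ+, fourierTerm (-1) z ω s k m) := by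
  have hp := im_removeNth_div_neg hω horc
  constructor
  · intro z hz
    have hw := im_sub_neg_of_mem hω horc hr hz
    refine ⟨hasBarnesZeta_neg hω horc hw, hasBarnesZeta_sum_sub hω horc hw,
      fun k => hasBilateralZeta_removeNth hω horc (hw k), fun s => ⟨?_, fun k => ?_, ?_⟩⟩
    · rw [fPlus_eq_sum_bilateralSeries hω horc hw]
      refine Finset.sum_congr rfl fun k _ => ?_
      rw [bilateralZeta_eq_bilateralSeries (hω k) (hw k) (hp k)]
    · refine ((summable_bilateralTerm (two_pi_I_mul_re_pos (hw k))
        (fun j => two_pi_I_mul_re_pos (hp k j)) s).mul_left ((-1) ^ (k : ℕ))).congr fun m => ?_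
      rw [fourierTerm_one_eq]
    · rw [fPlus_eq_sum_bilateralSeries hω horc hw, Finset.mul_sum]
      refine Finset.sum_congr rfl fun k _ => ?_
      simp only [fourierTerm_one_eq, tsum_mul_left, bilateralSeries]
      ring
  · intro z hz
    have hv := im_sub_sum_Ioi_neg_of_mem hω horc hr hz
    have hk0 : ∀ k, ω k ≠ 0 := fun k h0 => by simpa [h0] using hω k
    -- The results for w are applied with w = |ω| − z; the base points then differ from the required
    -- ones by ω_k only.
    have hsub : ∀ k, (∑ j ∈ Finset.Iio k, ω j) - ((∑ j, ω j) - z) =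
        (z - ∑ j ∈ Finset.Ioi k, ω j) - ω k := fun k => by
      rw [sum_eq_add_sum_Ioi ω k]
      ring
    have hw : ∀ k, (((∑ j ∈ Finset.Iio k, ω j) - ((∑ j, ω j) - z)) / ω k).im < 0 := fun k => by
      rw [hsub, sub_div _ (ω k), div_self (hk0 k), Complex.sub_im, Complex.one_im, sub_zero]
      exact hv k
    have h1 := hasBarnesZeta_neg hω horc hw
    have h2 := hasBarnesZeta_sum_sub hω horc hw
    have hf : ∀ s, fMinus z ω s = ∑ k : Fin (n + 1), (-1) ^ (n - (k : ℕ)) *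
        bilateralSeries (z - ∑ j ∈ Finset.Ioi k, ω j) (ω k) (k.removeNth (negFrom k ω)) s := by
      intro s
      have h := fMinus_eq_sum_bilateralSeries hω horc hw s
      rw [sub_sub_cancel] at h
      rw [h]
      refine Finset.sum_congr rfl fun k _ => ?_
      rw [hsub, bilateralSeries_sub (hk0 k)]
    rw [neg_sub] at h1
    rw [sub_sub_cancel] at h2
    refine ⟨h2, h1, fun k => hasBilateralZeta_removeNth hω horc (hv k),
      fun s => ⟨?_, fun k => ?_, ?_⟩⟩
    · rw [hf]
      refine Finset.sum_congr rfl fun k _ => ?_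
      rw [bilateralZeta_eq_bilateralSeries (hω k) (hv k) (hp k)]
    · refine ((summable_bilateralTerm (two_pi_I_mul_re_pos (hv k))
        (fun j => two_pi_I_mul_re_pos (hp k j)) s).mul_left ((-1) ^ (n - (k : ℕ)))).congr
        fun m => ?_
      rw [fourierTerm_neg_one_eq]
    · rw [hf, Finset.mul_sum]
      refine Finset.sum_congr rfl fun k _ => ?_
      simp only [fourierTerm_neg_one_eq, tsum_mul_left, bilateralSeries]
      ring
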